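/- Let $G$ be a discrete group and $A$ a $C^*$-algebra. A partial action $\alpha$ of $G$ on $A$ consists of closed two-sided ideals $\{D_s\}_{s\in G}$ of $A$ and $*$-isomorphisms $\alpha_s\colon D_{s^{-1}}\to D_s$ such that $D_e=A$ and, for all $s,t\in G$, $\alpha_{st}$ extends $\alpha_s\alpha_t$ (whose domain is $\{x\in D_{t^{-1}} : \alpha_t(x)\in D_{s^{-1}}\}$). Let $L_c$ be the $*$-algebra of finitely supported functions $f\colon G\to A$ with $f(s)\in D_s$ for all $s$; writing $F(a,s)$, for $a\in D_s$, for the function with value $a$ at $s$ and $0$ elsewhere, its operations are determined by $$F(a,s)F(b,t)=F(\alpha_s(\alpha_s^{-1}(a)b),st),\qquad F(a,s)^*=F(\alpha_s^{-1}(a^*),s^{-1}).$$ The crossed product $A\rtimes_\alpha G$ is the completion of $L_c$ in its greatest $C^*$-seminorm. Let $X_s=\{F(a,s): a\in D_s\}\subset A\rtimes_\alpha G$, and let $m_s$ be the multiplier of the $D_s$–$D_{s^{-1}}$ bimodule $X_s$ given by $a m_s=F(a,s)$ for $a\in D_s$ and $m_s b=F(\alpha_s(b),s)$ for $b\in D_{s^{-1}}$.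 Let $C^*(G)$ be the full group $C^*$-algebra, let $s\in G$ also denote the corresponding unitary in $C^*(G)$, let $\otimes$ be the minimal tensor product of $C^*$-algebras, and let $\delta_G\colon C^*(G)\to C^*(G)\otimes C^*(G)$ be the $*$-homomorphism with $\delta_G(s)=s\otimes s$. A coaction of $G$ on a $C^*$-algebra $B$ is an injective nondegenerate $*$-homomorphism $\delta\colon B\to B\otimes C^*(G)$ such that $(\delta\otimes\mathrm{id})\circ\delta=(\mathrm{id}\otimes\delta_G)\circ\delta$; here nondegenerate means that the linear span of $\delta(B)(B\otimes C^*(G))$ is dense in $B\otimes C^*(G)$. For $s\in G$ its spectral subspace is $B_s=\{b\in B:\delta(b)=b\otimes s\}$. **Proposition.** For every partial action $\alpha$ of a discrete group $G$ on a $C^*$-algebra $A$ there is a unique coaction $\hat\alpha$ of $G$ on $A\rtimes_\alpha G$ such that $$\hat\alpha(a m_s)=a m_s\otimes s\qquad\text{for all } s\in G,\ a\in D_s .$$ Its spectral subspaces are $$(A\rtimes_\alpha G)_s=D_s m_s=m_s D_{s^{-1}}\qquad (s\in G),$$ where $D_sm_s=\{am_s: a\in D_s\}$ and $m_sD_{s^{-1}}=\{m_sb: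 b\in D_{s^{-1}}\}$. -/

import Mathlib

universe u v w

set_option linter.unusedSectionVars false

open scoped TensorProduct

noncomputable section

/-! ### Completing a seminormed *-algebra whose seminorm satisfies the C*-identity -/

namespace CStarCompletion

open UniformSpace

variable (E : Type*) [NonUnitalSeminormedRing E] [StarRing E] [NormedSpace ℂ E]
  [IsScalarTower ℂ E E] [SMulCommClass ℂ E E] [StarModule ℂ E] [NormedStarGroup E]

variable {E} in
theorem norm_mul_completion_le (x : E) (y : Completion E) :
    ‖(ContinuousLinearMap.mul ℂ E x).completion y‖ ≤ ‖x‖ * ‖y‖ := by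
  induction y using Completion.induction_on with
  | hp => exact isClosed_le (by fun_prop) (by fun_prop)
  | ih y => simpa using norm_mul_le x y

/-- Left multiplication by elements of `E`, as operators on the completion. -/
def mulLeft : E →L[ℂ] (Completion E →L[ℂ] Completion E) :=
  LinearMap.mkContinuous
    { toFun := fun x => (ContinuousLinearMap.mul ℂ E x).completion
      map_add' := fun x y => by
        ext z
        induction z using Completion.induction_on with
        | hp => exact isClosed_eq (ContinuousLinearMap.continuous _) (ContinuousLinearMap.continuous _)
        | ih z => simp [Completion.coe_add]
      map_smul' := fun c x => by
        ext z
        induction z using Completion.induction_on with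
        | hp => exact isClosed_eq (ContinuousLinearMap.continuous _) (ContinuousLinearMap.continuous _)
        | ih z => simp [Completion.coe_smul] }
    1 (fun x => by
      rw [one_mul]
      exact ContinuousLinearMap.opNorm_le_bound _ (norm_nonneg x) (norm_mul_completion_le x))

/-- Multiplication of the completion as a continuous bilinear map. -/
def mulL : Completion E →L[ℂ] Completion E →L[ℂ] Completion E :=
  (mulLeft E).fromCompletion

theorem mulL_coe (x y : E) :
    mulL E (x : Completion E) (y : Completion E) = ((x * y : E) : Completion E) := by
  rw [mulL, ContinuousLinearMap.fromCompletion_apply_coe]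
  exact ContinuousLinearMap.completion_apply_coe (ContinuousLinearMap.mul ℂ E x) y

/-- The involution of the completion. -/
def starC : Completion E → Completion E := Completion.map star

theorem starC_coe (x : E) : starC E (x : Completion E) = ((star x : E) : Completion E) :=
  Completion.map_coe (starₗᵢ ℂ (E := E)).isometry.uniformContinuous x

theorem continuous_starC : Continuous (starC E) := Completion.continuous_map

theorem continuous_mulL₂ {X : Type*} [TopologicalSpace X] {f g : X → Completion E}
    (hf : Continuous f) (hg : Continuous g) : Continuous fun x => mulL E (f x) (g x) :=
  (mulL E).continuous₂.comp (hf.prodMk hg)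

/-- The multiplication of the completion. -/
abbrev nonUnitalNormedRing : NonUnitalNormedRing (Completion E) where
  __ := (inferInstance : NormedAddCommGroup (Completion E))
  mul x y := mulL E x y
  left_distrib x y z := map_add (mulL E x) y z
  right_distrib x y z := by
    change mulL E (x + y) z = mulL E x z + mulL E y z
    simp
  zero_mul x := by change mulL E 0 x = 0; simp
  mul_zero x := by change mulL E x 0 = 0; simp
  mul_assoc x y z := by
    change mulL E (mulL E x y) z = mulL E x (mulL E y z)
    induction x, y, z using Completion.induction_on₃ with
    | hp =>
      refine isClosed_eq ?_ ?_
      · exact continuous_mulL₂ E (continuous_mulL₂ E (by fun_prop) (by fun_prop)) (by fun_prop)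
      · exact continuous_mulL₂ E (by fun_prop) (continuous_mulL₂ E (by fun_prop) (by fun_prop))
    | ih a b c => simp only [mulL_coe, mul_assoc]
  norm_mul_le x y := by
    change ‖mulL E x y‖ ≤ ‖x‖ * ‖y‖
    induction x, y using Completion.induction_on₂ with
    | hp =>
      exact isClosed_le (continuous_mulL₂ E (by fun_prop) (by fun_prop)).norm (by fun_prop)
    | ih a b => simpa only [mulL_coe, Completion.norm_coe] using norm_mul_le a b

/-- The completion is a C*-algebra. -/
abbrev cstarAlgebra (hE : ∀ x : E, ‖x‖ * ‖x‖ ≤ ‖star x * x‖) :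
    NonUnitalCStarAlgebra (Completion E) where
  __ := nonUnitalNormedRing E
  __ := (inferInstance : NormedSpace ℂ (Completion E))
  __ := (inferInstance : CompleteSpace (Completion E))
  star := starC E
  star_involutive x := by
    induction x using Completion.induction_on with
    | hp => exact isClosed_eq ((continuous_starC E).comp (continuous_starC E)) continuous_id
    | ih a => simp only [starC_coe, star_star]
  star_mul x y := by
    change starC E (mulL E x y) = mulL E (starC E y) (starC E x)
    have hc := continuous_starC E
    induction x, y using Completion.induction_on₂ with
    | hp =>
      exact isClosed_eq (hc.comp (continuous_mulL₂ E (by fun_prop) (by fun_prop)))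
        (continuous_mulL₂ E (by fun_prop) (by fun_prop))
    | ih a b => simp only [mulL_coe, starC_coe, star_mul]
  star_add x y := by
    change starC E (x + y) = starC E x + starC E y
    have hc := continuous_starC E
    induction x, y using Completion.induction_on₂ with
    | hp => exact isClosed_eq (by fun_prop) (by fun_prop)
    | ih a b => simp only [← Completion.coe_add, starC_coe, star_add]
  norm_mul_self_le x := by
    change ‖x‖ * ‖x‖ ≤ ‖mulL E (starC E x) x‖
    have hc := continuous_starC E
    induction x using Completion.induction_on with
    | hp => exact isClosed_le (by fun_prop) (continuous_mulL₂ E (by fun_prop) (by fun_prop)).norm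
    | ih a =>
      simp only [starC_coe, mulL_coe, Completion.norm_coe]
      exact hE a
  smul_assoc c x y := by
    change mulL E (c • x) y = c • mulL E x y
    simp
  smul_comm c x y := by
    change c • mulL E x y = mulL E x (c • y)
    simp
  star_smul c x := by
    change starC E (c • x) = star c • starC E x
    have hc := continuous_starC E
    induction x using Completion.induction_on with
    | hp => exact isClosed_eq (hc.comp (continuous_const_smul c)) (hc.const_smul (star c))
    | ih a => simp only [← Completion.coe_smul, starC_coe, star_smul]

end CStarCompletion

/-! ### C*-seminorms and C*-completions of *-algebras -/

/-- A C*-seminorm on a complex *-algebra: a submultiplicative seminorm with `p (x* x) = p x ^ 2`. -/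
structure CStarSeminorm (L : Type*) [NonUnitalRing L] [StarRing L] [Module ℂ L] extends
    Seminorm ℂ L where
  mul_le' : ∀ x y, toFun (x * y) ≤ toFun x * toFun y
  star_mul_self' : ∀ x, toFun (star x * x) = toFun x * toFun x

namespace CStarSeminorm

section Basic

variable {L : Type*} [NonUnitalRing L] [StarRing L] [Module ℂ L]

instance : CoeFun (CStarSeminorm L) (fun _ => L → ℝ) := ⟨fun p => p.toSeminorm⟩

theorem mul_le (p : CStarSeminorm L) (x y : L) : p (x * y) ≤ p x * p y := p.mul_le' x y

theorem star_mul_self (p : CStarSeminorm L) (x : L) : p (star x * x) = p x * p x :=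
  p.star_mul_self' x

theorem nonneg (p : CStarSeminorm L) (x : L) : 0 ≤ p x := apply_nonneg p.toSeminorm x

theorem le_star (p : CStarSeminorm L) (x : L) : p x ≤ p (star x) := by
  rcases (p.nonneg x).eq_or_lt with h | h
  · rw [← h]; exact p.nonneg _
  · have := p.mul_le (star x) x
    rw [p.star_mul_self] at this
    exact le_of_mul_le_mul_right this h

theorem star_eq (p : CStarSeminorm L) (x : L) : p (star x) = p x :=
  le_antisymm (by simpa using p.le_star (star x)) (p.le_star x)

/-- The pointwise supremum of a pointwise bounded family of C*-seminorms. -/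
def sup {ι : Type*} (p : ι → CStarSeminorm L) (h : ∀ x, BddAbove (Set.range fun i => p i x)) :
    CStarSeminorm L where
  toFun x := ⨆ i, p i x
  map_zero' := by simp
  add_le' x y := by
    have h0 : ∀ z, 0 ≤ ⨆ i, p i z := fun z => Real.iSup_nonneg fun i => (p i).nonneg z
    refine Real.iSup_le (fun i => ?_) (add_nonneg (h0 x) (h0 y))
    exact (map_add_le_add (p i).toSeminorm x y).trans
      (add_le_add (le_ciSup (h x) i) (le_ciSup (h y) i))
  neg' x := by simp
  smul' c x := by
    simp only [map_smul_eq_mul]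
    rw [Real.mul_iSup_of_nonneg (norm_nonneg c)]
  mul_le' x y := by
    have h0 : ∀ z, 0 ≤ ⨆ i, p i z := fun z => Real.iSup_nonneg fun i => (p i).nonneg z
    refine Real.iSup_le (fun i => ?_) (mul_nonneg (h0 x) (h0 y))
    exact ((p i).mul_le x y).trans
      (mul_le_mul (le_ciSup (h x) i) (le_ciSup (h y) i) ((p i).nonneg y) (h0 x))
  star_mul_self' x := by
    have h0 : ∀ z, 0 ≤ ⨆ i, p i z := fun z => Real.iSup_nonneg fun i => (p i).nonneg z
    apply le_antisymm
    · refine Real.iSup_le (fun i => ?_) (mul_nonneg (h0 x) (h0 x))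
      rw [(p i).star_mul_self]
      exact mul_le_mul (le_ciSup (h x) i) (le_ciSup (h x) i) ((p i).nonneg x) (h0 x)
    · rw [← sq]
      refine (Real.le_sqrt (h0 x) (h0 _)).1 (Real.iSup_le (fun i => ?_) (Real.sqrt_nonneg _))
      refine (Real.le_sqrt ((p i).nonneg x) (h0 _)).2 ?_
      rw [sq, ← (p i).star_mul_self]
      exact le_ciSup (h (star x * x)) i

theorem le_sup {ι : Type*} (p : ι → CStarSeminorm L)
    (h : ∀ x, BddAbove (Set.range fun i => p i x)) (i : ι) (x : L) : p i x ≤ sup p h x :=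
  le_ciSup (h x) i

theorem sup_le {ι : Type*} (p : ι → CStarSeminorm L)
    (h : ∀ x, BddAbove (Set.range fun i => p i x)) {x : L} {c : ℝ} (hc : 0 ≤ c)
    (hx : ∀ i, p i x ≤ c) : sup p h x ≤ c :=
  Real.iSup_le hx hc

/-- The C*-seminorm `x ↦ ‖φ x‖` of a *-homomorphism `φ` into a C*-algebra. -/
def ofHom {B : Type*} [NonUnitalCStarAlgebra B] (φ : L →⋆ₙₐ[ℂ] B) : CStarSeminorm L where
  toFun x := ‖φ x‖
  map_zero' := by simp
  add_le' x y := by rw [map_add]; exact norm_add_le _ _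
  neg' x := by rw [map_neg, norm_neg]
  smul' c x := by rw [map_smul, norm_smul]
  mul_le' x y := by rw [map_mul]; exact norm_mul_le _ _
  star_mul_self' x := by rw [map_mul, map_star, CStarRing.norm_star_mul_self]

theorem ofHom_apply {B : Type*} [NonUnitalCStarAlgebra B] (φ : L →⋆ₙₐ[ℂ] B) (x : L) :
    ofHom φ x = ‖φ x‖ := rfl

end Basic

section Completion

variable {L : Type*} [NonUnitalRing L] [StarRing L] [Module ℂ L] [IsScalarTower ℂ L L]
  [SMulCommClass ℂ L L] [StarModule ℂ L]

/-- The *-algebra `L`, equipped with the topology of the C*-seminorm `p`. -/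
def Dom (_ : CStarSeminorm L) : Type _ := L

variable (p : CStarSeminorm L)

instance : NonUnitalSeminormedRing p.Dom where
  __ := (inferInstanceAs (NonUnitalRing L) : NonUnitalRing p.Dom)
  __ : SeminormedAddCommGroup p.Dom := p.toSeminorm.toSeminormedAddCommGroup
  norm_mul_le := p.mul_le

instance : StarRing p.Dom := inferInstanceAs (StarRing L)

instance : NormedSpace ℂ p.Dom where
  __ := (inferInstanceAs (Module ℂ L) : Module ℂ p.Dom)
  norm_smul_le c x := (map_smul_eq_mul p.toSeminorm c x).le

instance : IsScalarTower ℂ p.Dom p.Dom := inferInstanceAs (IsScalarTower ℂ L L)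
instance : SMulCommClass ℂ p.Dom p.Dom := inferInstanceAs (SMulCommClass ℂ L L)
instance : StarModule ℂ p.Dom := inferInstanceAs (StarModule ℂ L)

instance : NormedStarGroup p.Dom where
  norm_star_le x := (p.star_eq (x : L)).le

/-- The identity map, as a *-homomorphism. -/
def toDom : L →⋆ₙₐ[ℂ] p.Dom where
  toFun x := x
  map_smul' _ _ := rfl
  map_zero' := rfl
  map_add' _ _ := rfl
  map_mul' _ _ := rfl
  map_star' _ := rfl

/-- The C*-completion of a *-algebra in a C*-seminorm (its Hausdorff completion). -/
def Completion : Type _ := UniformSpace.Completion p.Dom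

instance : NonUnitalCStarAlgebra p.Completion := 
  CStarCompletion.cstarAlgebra p.Dom fun x => (p.star_mul_self (x : L)).ge

/-- The canonical *-homomorphism of `L` into its completion. -/
def toCompletion : L →⋆ₙₐ[ℂ] p.Completion where
  toFun x := ((p.toDom x : p.Dom) : UniformSpace.Completion p.Dom)
  map_smul' c x := UniformSpace.Completion.coe_smul c (p.toDom x)
  map_zero' := UniformSpace.Completion.coe_zero
  map_add' x y := UniformSpace.Completion.coe_add (p.toDom x) (p.toDom y)
  map_mul' x y := (CStarCompletion.mulL_coe p.Dom (p.toDom x) (p.toDom y)).symm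
  map_star' x := (CStarCompletion.starC_coe p.Dom (p.toDom x)).symm

theorem norm_toCompletion (x : L) : ‖p.toCompletion x‖ = p x :=
  UniformSpace.Completion.norm_coe (p.toDom x)

theorem denseRange_toCompletion : DenseRange p.toCompletion :=
  UniformSpace.Completion.denseRange_coe (α := p.Dom)

variable {B : Type*} [NonUnitalCStarAlgebra B]

/-- The continuous linear extension underlying `CStarSeminorm.lift`. -/
def liftL (φ : L →⋆ₙₐ[ℂ] B) (h : ∀ x, ‖φ x‖ ≤ p x) : p.Completion →L[ℂ] B :=
  (LinearMap.mkContinuous (E := p.Dom)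
    { toFun := fun x => φ x
      map_add' := fun x y => map_add φ _ _
      map_smul' := fun c x => map_smul φ c _ } 1
    (fun x => by rw [one_mul]; exact h x)).fromCompletion

theorem liftL_coe (φ : L →⋆ₙₐ[ℂ] B) (h : ∀ x, ‖φ x‖ ≤ p x) (x : L) :
    p.liftL φ h (p.toCompletion x) = φ x :=
  ContinuousLinearMap.fromCompletion_apply_coe (α := p.Dom) _ x

/-- A *-homomorphism of `L` into a C*-algebra which is dominated by `p` extends to the
completion. -/
def lift (φ : L →⋆ₙₐ[ℂ] B) (h : ∀ x, ‖φ x‖ ≤ p x) : p.Completion →⋆ₙₐ[ℂ] B where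
  __ := p.liftL φ h
  map_zero' := map_zero (p.liftL φ h)
  map_mul' x y := by
    refine p.denseRange_toCompletion.induction_on₂
      (p := fun x y => p.liftL φ h (x * y) = p.liftL φ h x * p.liftL φ h y) ?_ (fun a b => ?_) x y
    · exact isClosed_eq (by fun_prop) (by fun_prop)
    · rw [← map_mul, liftL_coe, liftL_coe, liftL_coe, map_mul]
  map_star' x := by
    refine p.denseRange_toCompletion.induction_on
      (p := fun x => p.liftL φ h (star x) = star (p.liftL φ h x)) x ?_ (fun a => ?_)
    · exact isClosed_eq (by fun_prop) (by fun_prop)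
    · rw [← map_star, liftL_coe, liftL_coe, map_star]

theorem lift_coe (φ : L →⋆ₙₐ[ℂ] B) (h : ∀ x, ‖φ x‖ ≤ p x) (x : L) :
    p.lift φ h (p.toCompletion x) = φ x := p.liftL_coe φ h x

end Completion
end CStarSeminorm
/-! ### Enveloping C*-algebras -/

/-- Every element of `L` has bounded C*-seminorms, so that a greatest C*-seminorm exists. -/
class IsCStarBounded (L : Type*) [NonUnitalRing L] [StarRing L] [Module ℂ L] : Prop where
  bddAbove : ∀ x : L, BddAbove (Set.range fun p : CStarSeminorm L => p x)

section Envelope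

variable (L : Type*) [NonUnitalRing L] [StarRing L] [Module ℂ L] [IsScalarTower ℂ L L]
  [SMulCommClass ℂ L L] [StarModule ℂ L] [IsCStarBounded L]

/-- The greatest C*-seminorm on `L`. -/
def greatestCStarSeminorm : CStarSeminorm L :=
  CStarSeminorm.sup (fun p : CStarSeminorm L => p) IsCStarBounded.bddAbove

/-- The enveloping C*-algebra of `L`: its completion in the greatest C*-seminorm. -/
def EnvelopingCStar : Type _ := (greatestCStarSeminorm L).Completion

instance : NonUnitalCStarAlgebra (EnvelopingCStar L) :=
  inferInstanceAs (NonUnitalCStarAlgebra (greatestCStarSeminorm L).Completion)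

namespace EnvelopingCStar

variable {L}

/-- The canonical *-homomorphism of `L` into its enveloping C*-algebra. -/
def of : L →⋆ₙₐ[ℂ] EnvelopingCStar L := (greatestCStarSeminorm L).toCompletion

theorem norm_of (x : L) : ‖of x‖ = greatestCStarSeminorm L x :=
  (greatestCStarSeminorm L).norm_toCompletion x

theorem denseRange_of : DenseRange (of : L → EnvelopingCStar L) :=
  (greatestCStarSeminorm L).denseRange_toCompletion

/-- Every *-homomorphism of `L` into a C*-algebra extends to the enveloping C*-algebra. -/
def lift {B : Type*} [NonUnitalCStarAlgebra B] (φ : L →⋆ₙₐ[ℂ] B) : EnvelopingCStar L →⋆ₙₐ[ℂ] B :=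
  (greatestCStarSeminorm L).lift φ fun x =>
    CStarSeminorm.le_sup (fun p : CStarSeminorm L => p) IsCStarBounded.bddAbove
      (CStarSeminorm.ofHom φ) x

theorem lift_of {B : Type*} [NonUnitalCStarAlgebra B] (φ : L →⋆ₙₐ[ℂ] B) (x : L) :
    lift φ (of x) = φ x :=
  (greatestCStarSeminorm L).lift_coe φ _ x

end EnvelopingCStar

end Envelope

/-! ### The full group C*-algebra of a discrete group -/

section GroupCStar

open MonoidAlgebra

variable (G : Type v) [Group G]

/-- The involution of the complex group algebra: `f* (s) = conj (f (s⁻¹))`. -/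
instance : Star (MonoidAlgebra ℂ G) :=
  ⟨fun f => MonoidAlgebra.ofCoeff
    (Finsupp.equivMapDomain (Equiv.inv G) (f.coeff.mapRange star (star_zero ℂ)))⟩

variable {G}

theorem MonoidAlgebra.coeff_star_apply (f : MonoidAlgebra ℂ G) (s : G) :
    (star f).coeff s = star (f.coeff s⁻¹) := rfl

theorem MonoidAlgebra.star_single (s : G) (c : ℂ) :
    star (single s c : MonoidAlgebra ℂ G) = single s⁻¹ (star c) := by
  classical
  ext t
  rw [MonoidAlgebra.coeff_star_apply]
  simp only [MonoidAlgebra.coeff_single, Finsupp.single_apply, inv_eq_iff_eq_inv]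
  split_ifs <;> simp

instance : StarAddMonoid (MonoidAlgebra ℂ G) where
  star_involutive f := by ext s; simp [MonoidAlgebra.coeff_star_apply]
  star_add f g := by ext s; simp [MonoidAlgebra.coeff_star_apply]

instance : StarRing (MonoidAlgebra ℂ G) where
  __ := (inferInstance : StarAddMonoid (MonoidAlgebra ℂ G))
  star_mul f g := by
    induction f using MonoidAlgebra.induction_linear with
    | zero => simp
    | add f₁ f₂ h₁ h₂ => rw [add_mul, star_add, h₁, h₂, star_add, mul_add]
    | single s c =>
      induction g using MonoidAlgebra.induction_linear with
      | zero => simp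
      | add f₁ f₂ h₁ h₂ => rw [mul_add, star_add, h₁, h₂, star_add, add_mul]
      | single t d =>
        simp only [MonoidAlgebra.star_single, MonoidAlgebra.single_mul_single, mul_inv_rev, star_mul]

instance : StarModule ℂ (MonoidAlgebra ℂ G) where
  star_smul c f := by ext s; simp [MonoidAlgebra.coeff_star_apply]

instance : IsCStarBounded (MonoidAlgebra ℂ G) where
  bddAbove f := by
    induction f using MonoidAlgebra.induction_linear with
    | zero => exact ⟨0, by rintro _ ⟨p, rfl⟩; simp⟩
    | add f₁ f₂ h₁ h₂ =>
      obtain ⟨c₁, h₁⟩ := h₁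
      obtain ⟨c₂, h₂⟩ := h₂
      refine ⟨c₁ + c₂, ?_⟩
      rintro _ ⟨p, rfl⟩
      exact (map_add_le_add p.toSeminorm f₁ f₂).trans
        (add_le_add (h₁ ⟨p, rfl⟩) (h₂ ⟨p, rfl⟩))
    | single s c =>
      refine ⟨‖c‖, ?_⟩
      rintro _ ⟨p, rfl⟩
      have h1 : p (1 : MonoidAlgebra ℂ G) ≤ 1 := by
        have h := p.star_mul_self 1
        rw [star_one, one_mul] at h
        have h0 := p.nonneg 1
        by_contra! hlt
        nlinarith
      have h2 := p.star_mul_self (single s c)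
      rw [MonoidAlgebra.star_single, MonoidAlgebra.single_mul_single, inv_mul_cancel,
        ← mul_one (star c * c), ← smul_eq_mul (star c * c), ← MonoidAlgebra.smul_single,
        ← MonoidAlgebra.one_def, map_smul_eq_mul, norm_mul, norm_star] at h2
      have h3 := p.nonneg (single s c)
      have h4 := norm_nonneg c
      by_contra! hlt
      change ‖c‖ < p (single s c) at hlt
      nlinarith [mul_nonneg h4 h4]

variable (G)

/-- The full group C*-algebra `C*(G)` of the discrete group `G`. -/
def GroupCStar : Type v := EnvelopingCStar (MonoidAlgebra ℂ G)

instance : NonUnitalCStarAlgebra (GroupCStar G) :=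
  inferInstanceAs (NonUnitalCStarAlgebra (EnvelopingCStar (MonoidAlgebra ℂ G)))

/-- The canonical *-homomorphism of the group algebra into `C*(G)`. -/
def GroupCStar.of : MonoidAlgebra ℂ G →⋆ₙₐ[ℂ] GroupCStar G :=
  EnvelopingCStar.of (L := MonoidAlgebra ℂ G)

variable {G}

/-- The canonical unitary of `C*(G)` attached to `s : G`. -/
def GroupCStar.unitary (s : G) : GroupCStar G := GroupCStar.of G (single s 1)

end GroupCStar

/-! ### Partial actions -/

/-- A partial action of the discrete group `G` on the C*-algebra `A`: closed two-sided ideals `D s`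
of `A` (closed ideals of C*-algebras are automatically self-adjoint) and *-isomorphisms
`α s : D s⁻¹ → D s` such that `D 1 = A` and `α (s * t)` extends `α s ∘ α t`, whose domain is
`{x ∈ D t⁻¹ | α t x ∈ D s⁻¹}`. -/
structure PartialAction (G : Type v) [Group G] (A : Type u) [NonUnitalCStarAlgebra A] where
  D : G → NonUnitalStarSubalgebra ℂ A
  isClosed : ∀ s, IsClosed (D s : Set A)
  mul_mem_left : ∀ (s : G) (a : A) {x : A}, x ∈ D s → a * x ∈ D s
  mul_mem_right : ∀ (s : G) (a : A) {x : A}, x ∈ D s → x * a ∈ D s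
  α : ∀ s : G, D s⁻¹ ≃⋆ₐ[ℂ] D s
  D_one : D 1 = ⊤
  extends_comp : ∀ (s t : G) (x : D t⁻¹) (h : (α t x : A) ∈ D s⁻¹),
    ∃ h' : (x : A) ∈ D (s * t)⁻¹, (α (s * t) ⟨x, h'⟩ : A) = α s ⟨α t x, h⟩

namespace PartialAction

variable {G : Type v} [Group G] {A : Type u} [NonUnitalCStarAlgebra A] (θ : PartialAction G A)

/-- `θ.Maps s a b` says that `a` is in the domain of `α s`, with value `b`. -/
def Maps (s : G) (a b : A) : Prop := ∃ h : a ∈ θ.D s⁻¹, (θ.α s ⟨a, h⟩ : A) = b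

variable {θ}

theorem Maps.mem {s : G} {a b : A} (h : θ.Maps s a b) : b ∈ θ.D s := by
  obtain ⟨ha, rfl⟩ := h
  exact (θ.α s ⟨a, ha⟩).2

theorem Maps.mem' {s : G} {a b : A} (h : θ.Maps s a b) : a ∈ θ.D s⁻¹ := h.1

theorem maps_apply (s : G) (a : θ.D s⁻¹) : θ.Maps s a (θ.α s a) := ⟨a.2, rfl⟩

theorem maps_symm (s : G) (a : θ.D s) : θ.Maps s ((θ.α s).symm a) a :=
  ⟨((θ.α s).symm a).2, by simp⟩

theorem exists_maps {s : G} {a : A} (ha : a ∈ θ.D s⁻¹) : ∃ b, θ.Maps s a b :=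
  ⟨_, maps_apply s ⟨a, ha⟩⟩

theorem exists_maps_symm {s : G} {a : A} (ha : a ∈ θ.D s) : ∃ a', θ.Maps s a' a :=
  ⟨_, maps_symm s ⟨a, ha⟩⟩

theorem Maps.eq {s : G} {a b b' : A} (h : θ.Maps s a b) (h' : θ.Maps s a b') : b = b' := by
  obtain ⟨_, rfl⟩ := h
  obtain ⟨_, rfl⟩ := h'
  rfl

theorem Maps.comp {s t : G} {a b c : A} (h : θ.Maps t a b) (h' : θ.Maps s b c) :
    θ.Maps (s * t) a c := by
  obtain ⟨ha, rfl⟩ := h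
  obtain ⟨hb, rfl⟩ := h'
  exact θ.extends_comp s t ⟨a, ha⟩ hb

theorem Maps.inj {s : G} {a a' b : A} (h : θ.Maps s a b) (h' : θ.Maps s a' b) : a = a' := by
  obtain ⟨ha, rfl⟩ := h
  obtain ⟨ha', h'⟩ := h'
  exact congrArg Subtype.val ((θ.α s).injective (Subtype.ext h')).symm

theorem Maps.mul {s : G} {a a' b b' : A} (h : θ.Maps s a b) (h' : θ.Maps s a' b') :
    θ.Maps s (a * a') (b * b') := by
  obtain ⟨ha, rfl⟩ := h
  obtain ⟨ha', rfl⟩ := h'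
  exact ⟨mul_mem ha ha', congrArg Subtype.val (map_mul (θ.α s) ⟨a, ha⟩ ⟨a', ha'⟩)⟩

theorem Maps.add {s : G} {a a' b b' : A} (h : θ.Maps s a b) (h' : θ.Maps s a' b') :
    θ.Maps s (a + a') (b + b') := by
  obtain ⟨ha, rfl⟩ := h
  obtain ⟨ha', rfl⟩ := h'
  exact ⟨add_mem ha ha', congrArg Subtype.val (map_add (θ.α s) ⟨a, ha⟩ ⟨a', ha'⟩)⟩

theorem Maps.smul {s : G} {a b : A} (c : ℂ) (h : θ.Maps s a b) : θ.Maps s (c • a) (c • b) := by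
  obtain ⟨ha, rfl⟩ := h
  exact ⟨SMulMemClass.smul_mem c ha, congrArg Subtype.val (map_smul (θ.α s) c ⟨a, ha⟩)⟩

theorem Maps.star {s : G} {a b : A} (h : θ.Maps s a b) : θ.Maps s (star a) (star b) := by
  obtain ⟨ha, rfl⟩ := h
  exact ⟨star_mem ha, congrArg Subtype.val (map_star (θ.α s) ⟨a, ha⟩)⟩

theorem mem_one (a : A) : a ∈ θ.D 1 := by rw [θ.D_one]; trivial

theorem maps_one (a : A) : θ.Maps 1 a a := by
  have ha : a ∈ θ.D (1 : G)⁻¹ := by rw [inv_one]; exact mem_one a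
  have hb : (θ.α 1 ⟨a, ha⟩ : A) ∈ θ.D (1 : G)⁻¹ :=
    (congrArg θ.D (inv_one (G := G))).ge (mem_one _)
  have h₁ := maps_apply (θ := θ) 1 ⟨a, ha⟩
  have h₂ := maps_apply (θ := θ) 1 ⟨_, hb⟩
  have h₃ := h₁.comp h₂
  rw [one_mul] at h₃
  rw [← h₁.eq h₃] at h₂
  have h₄ := h₁.inj h₂
  dsimp only at h₄
  rwa [← h₄] at h₁

theorem Maps.inv {s : G} {a b : A} (h : θ.Maps s a b) : θ.Maps s⁻¹ b a := by
  have hb : b ∈ θ.D s⁻¹⁻¹ := by rw [inv_inv]; exact h.mem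
  have h₁ := maps_apply (θ := θ) s⁻¹ ⟨b, hb⟩
  have h₂ := h.comp h₁
  rw [inv_mul_cancel] at h₂
  rwa [← (maps_one a).eq h₂] at h₁

/-- Left multiplication by `A` on `D t` commutes with right multiplication by `A` transported
through `α t`. -/
theorem Maps.mul_comm_mul {t : G} {x b b' y c w : A} (hb : θ.Maps t b' b)
    (hy : θ.Maps t y (x * b)) (hw : θ.Maps t (b' * c) w) : θ.Maps t (y * c) (x * w) := by
  obtain ⟨q, hq⟩ := exists_maps (θ.mul_mem_right _ c hy.mem')
  have key : ∀ d ∈ θ.D t, d * q = d * (x * w) := by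
    intro d hd
    obtain ⟨d', hd'⟩ := exists_maps_symm hd
    obtain ⟨e, he⟩ := exists_maps_symm (θ.mul_mem_right _ x hd)
    have h₁ := hd'.mul hy
    have h₂ := he.mul hb
    rw [mul_assoc d x b] at h₂
    have h₃ := h₁.inj h₂
    have h₄ := hd'.mul hq
    have h₅ := he.mul hw
    rw [← mul_assoc, ← h₃, mul_assoc d' y c] at h₅
    rw [h₄.eq h₅, mul_assoc]
  have hmem : q - x * w ∈ θ.D t := sub_mem hq.mem (θ.mul_mem_left _ x hw.mem)
  have h0 : Star.star (q - x * w) * (q - x * w) = 0 := by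
    rw [mul_sub, key _ (star_mem hmem), sub_self]
  rw [CStarRing.star_mul_self_eq_zero_iff, sub_eq_zero] at h0
  rwa [h0] at hq

variable (θ)

/-! ### The *-algebra of finitely supported sections -/

theorem mulCoeff_aux (s t : G) (a : θ.D s) (b : θ.D t) :
    ((θ.α s).symm a : A) * b ∈ θ.D s⁻¹ :=
  θ.mul_mem_right _ _ ((θ.α s).symm a).2

theorem mulCoeff_mem (s t : G) (a : θ.D s) (b : θ.D t) :
    (θ.α s ⟨((θ.α s).symm a : A) * b, θ.mulCoeff_aux s t a b⟩ : A) ∈ θ.D (s * t) := by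
  have h₁ := maps_apply s ⟨((θ.α s).symm a : A) * b, θ.mulCoeff_aux s t a b⟩
  have h₂ := maps_symm t ⟨((θ.α s).symm a : A) * b, θ.mul_mem_left t _ b.2⟩
  exact (h₂.comp h₁).mem

/-- `α s (α s⁻¹ (a) b)`, the coefficient of the product of `F(a,s)` and `F(b,t)`. -/
def mulCoeff (s t : G) (a : θ.D s) (b : θ.D t) : θ.D (s * t) :=
  ⟨θ.α s ⟨((θ.α s).symm a : A) * b, θ.mulCoeff_aux s t a b⟩, θ.mulCoeff_mem s t a b⟩

variable {θ}

theorem Maps.mulCoeff {s t : G} {a : θ.D s} {b : θ.D t} {a' : A} (h : θ.Maps s a' a) :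
    θ.Maps s (a' * b) (θ.mulCoeff s t a b) := by
  rw [h.inj (maps_symm s a)]
  exact maps_apply s ⟨((θ.α s).symm a : A) * b, θ.mulCoeff_aux s t a b⟩

variable (θ)

/-- The product of sections supported at `s` and at `t`, as a bilinear map. -/
def mulCoeffₗ (s t : G) : θ.D s →ₗ[ℂ] θ.D t →ₗ[ℂ] θ.D (s * t) :=
  LinearMap.mk₂ ℂ (θ.mulCoeff s t)
    (fun a a' b => Subtype.ext <| by
      have h := ((maps_symm s a).add (maps_symm s a')).mulCoeff (a := a + a') (b := b)
      rw [add_mul] at h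
      exact h.eq ((maps_symm s a).mulCoeff.add (maps_symm s a').mulCoeff))
    (fun c a b => Subtype.ext <| by
      have h := ((maps_symm s a).smul c).mulCoeff (a := c • a) (b := b)
      rw [smul_mul_assoc] at h
      exact h.eq ((maps_symm s a).mulCoeff.smul c))
    (fun a b b' => Subtype.ext <| by
      have h := (maps_symm s a).mulCoeff (b := b + b')
      rw [NonUnitalStarSubalgebra.coe_add, mul_add] at h
      exact h.eq ((maps_symm s a).mulCoeff.add (maps_symm s a).mulCoeff))
    (fun c a b => Subtype.ext <| by
      have h := (maps_symm s a).mulCoeff (b := c • b)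
      rw [NonUnitalStarSubalgebra.coe_smul, mul_smul_comm] at h
      exact h.eq ((maps_symm s a).mulCoeff.smul c))

/-- The coefficient `α s⁻¹ (a*)` of `F(a,s)*`. -/
def starCoeff (s : G) : θ.D s →+ θ.D s⁻¹ where
  toFun a := (θ.α s).symm (star a)
  map_zero' := by simp
  map_add' a b := by simp

theorem maps_starCoeff (s : G) (a : θ.D s) : θ.Maps s (θ.starCoeff s a) (star (a : A)) :=
  maps_symm s (star a)

open scoped Classical in
/-- The vector space `L_c` of finitely supported functions `f : G → A` with `f s ∈ D s`. -/
def Sections : Type (max u v) := DirectSum G fun s => θ.D s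

namespace Sections

instance : AddCommGroup θ.Sections := inferInstanceAs (AddCommGroup (DirectSum G fun s => θ.D s))
instance : Module ℂ θ.Sections := inferInstanceAs (Module ℂ (DirectSum G fun s => θ.D s))

open scoped Classical in
/-- `F(a,s)`, the section with the value `a` at `s` and `0` elsewhere. -/
def F (s : G) : θ.D s →ₗ[ℂ] θ.Sections := DirectSum.lof ℂ G (fun s => θ.D s) s

variable {θ}

theorem F_congr {s t : G} (h : s = t) {a : θ.D s} {b : θ.D t} (hab : (a : A) = b) :
    F θ s a = F θ t b := by
  subst h
  rw [Subtype.ext hab]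

theorem induction {P : θ.Sections → Prop} (f : θ.Sections) (h0 : P 0)
    (hF : ∀ s a, P (F θ s a)) (hadd : ∀ f g, P f → P g → P (f + g)) : P f := by
  classical
  exact DirectSum.induction_on f h0 hF hadd

open scoped Classical in
/-- The linear map on `L_c` with prescribed values on the sections `F(a,s)`. -/
def lift {M : Type*} [AddCommGroup M] [Module ℂ M] (φ : ∀ s, θ.D s →ₗ[ℂ] M) :
    θ.Sections →ₗ[ℂ] M :=
  DirectSum.toModule ℂ G M φ

theorem lift_F {M : Type*} [AddCommGroup M] [Module ℂ M] (φ : ∀ s, θ.D s →ₗ[ℂ] M) (s : G)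
    (a : θ.D s) : lift φ (F θ s a) = φ s a := by
  classical
  exact DirectSum.toModule_lof (M := fun s => θ.D s) (φ := φ) ℂ s a

variable (θ)

/-- The multiplication of `L_c`, determined by `F(a,s) F(b,t) = F(α s (α s⁻¹ (a) b), s t)`. -/
def mulₗ : θ.Sections →ₗ[ℂ] θ.Sections →ₗ[ℂ] θ.Sections :=
  lift fun s => LinearMap.flip <| lift fun t => ((θ.mulCoeffₗ s t).compr₂ (F θ (s * t))).flip

instance : Mul θ.Sections := ⟨fun f g => mulₗ θ f g⟩

theorem F_mul_F (s t : G) (a : θ.D s) (b : θ.D t) :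
    F θ s a * F θ t b = F θ (s * t) (θ.mulCoeff s t a b) := by
  change mulₗ θ (F θ s a) (F θ t b) = _
  rw [mulₗ, lift_F, LinearMap.flip_apply, lift_F]
  rfl

instance : NonUnitalRing θ.Sections where
  __ := (inferInstance : AddCommGroup θ.Sections)
  left_distrib f g h := map_add (mulₗ θ f) g h
  right_distrib f g h := LinearMap.map_add₂ (mulₗ θ) f g h
  zero_mul f := LinearMap.map_zero₂ (mulₗ θ) f
  mul_zero f := map_zero (mulₗ θ f)
  mul_assoc f g h := by
    have hl : ∀ f g h : θ.Sections, (f + g) * h = f * h + g * h := LinearMap.map_add₂ (mulₗ θ)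
    have hr : ∀ f g h : θ.Sections, f * (g + h) = f * g + f * h := fun f => map_add (mulₗ θ f)
    have zl : ∀ f : θ.Sections, 0 * f = 0 := LinearMap.map_zero₂ (mulₗ θ)
    have zr : ∀ f : θ.Sections, f * 0 = 0 := fun f => map_zero (mulₗ θ f)
    induction f using Sections.induction with
    | h0 => simp only [zl]
    | hadd f₁ f₂ h₁ h₂ => simp only [hl, h₁, h₂]
    | hF s a =>
    induction g using Sections.induction with
    | h0 => simp only [zl, zr]
    | hadd f₁ f₂ h₁ h₂ => simp only [hl, hr, h₁, h₂]
    | hF t b =>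
    induction h using Sections.induction with
    | h0 => simp only [zr]
    | hadd f₁ f₂ h₁ h₂ => simp only [hr, h₁, h₂]
    | hF r c =>
    simp only [F_mul_F]
    refine F_congr (mul_assoc s t r) ?_
    obtain ⟨a', ha⟩ := exists_maps_symm a.2
    obtain ⟨b', hb⟩ := exists_maps_symm b.2
    obtain ⟨y, hy⟩ := exists_maps_symm (θ.mul_mem_left t a' b.2)
    have h₁ := (hy.comp ha.mulCoeff).mulCoeff (b := c)
    have h₂ := (hb.mul_comm_mul hy (hb.mulCoeff (b := c))).comp ha.mulCoeff
    exact h₁.eq h₂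

instance : IsScalarTower ℂ θ.Sections θ.Sections where
  smul_assoc c f g := LinearMap.map_smul₂ (mulₗ θ) c f g

instance : SMulCommClass ℂ θ.Sections θ.Sections where
  smul_comm c f g := (map_smul (mulₗ θ f) c g).symm

open scoped Classical in
/-- The involution of `L_c`, determined by `F(a,s)* = F(α s⁻¹ (a*), s⁻¹)`. -/
def starHom : θ.Sections →+ θ.Sections :=
  DirectSum.toAddMonoid fun s => (F θ s⁻¹).toAddMonoidHom.comp (θ.starCoeff s)

instance : Star θ.Sections := ⟨starHom θ⟩

theorem star_F (s : G) (a : θ.D s) : star (F θ s a) = F θ s⁻¹ (θ.starCoeff s a) := by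
  classical
  exact DirectSum.toAddMonoid_of
    (fun s => (F θ s⁻¹).toAddMonoidHom.comp (θ.starCoeff s)) s a

instance : StarRing θ.Sections where
  star_add := map_add (starHom θ)
  star_involutive f := by
    have hs : ∀ f g : θ.Sections, star (f + g) = star f + star g := map_add (starHom θ)
    have h0 : star (0 : θ.Sections) = 0 := map_zero (starHom θ)
    induction f using Sections.induction with
    | h0 => rw [h0, h0]
    | hadd f₁ f₂ h₁ h₂ => rw [hs, hs, h₁, h₂]
    | hF s a =>
      rw [star_F, star_F]
      refine F_congr (inv_inv s) ?_
      have h₁ := (θ.maps_starCoeff s a).star.inv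
      rw [star_star] at h₁
      exact (θ.maps_starCoeff _ _).inj h₁
  star_mul f g := by
    have hs : ∀ f g : θ.Sections, star (f + g) = star f + star g := map_add (starHom θ)
    have h0 : star (0 : θ.Sections) = 0 := map_zero (starHom θ)
    induction f using Sections.induction with
    | h0 => rw [zero_mul, h0, mul_zero]
    | hadd f₁ f₂ h₁ h₂ => rw [add_mul, hs, h₁, h₂, hs, mul_add]
    | hF s a =>
    induction g using Sections.induction with
    | h0 => rw [mul_zero, h0, zero_mul]
    | hadd f₁ f₂ h₁ h₂ => rw [mul_add, hs, h₁, h₂, hs, add_mul]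
    | hF t b =>
      simp only [F_mul_F, star_F]
      refine F_congr (mul_inv_rev s t) ?_
      have ha := (θ.maps_starCoeff s a).star
      rw [star_star] at ha
      have hb := (θ.maps_starCoeff t b).inv
      have h₁ := (hb.mulCoeff (b := θ.starCoeff s a)).inv
      rw [inv_inv] at h₁
      have h₂ := (ha.mulCoeff (b := b)).star
      rw [star_mul, star_star] at h₂
      exact (θ.maps_starCoeff _ _).inj (h₁.comp h₂)

instance : StarModule ℂ θ.Sections where
  star_smul c f := by
    induction f using Sections.induction with
    | h0 => simp
    | hadd f₁ f₂ h₁ h₂ => rw [smul_add, star_add, h₁, h₂, star_add, smul_add]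
    | hF s a =>
      rw [← map_smul, star_F, star_F, ← map_smul]
      refine F_congr rfl ?_
      have h₁ := (θ.maps_starCoeff s a).smul (star c)
      rw [← star_smul] at h₁
      exact (θ.maps_starCoeff s (c • a)).inj h₁

/-- The inclusion `a ↦ F(a,e)` of `A` in `L_c`. -/
def incl : A →⋆ₙₐ[ℂ] θ.Sections where
  toFun a := F θ 1 ⟨a, mem_one a⟩
  map_smul' c a := by rw [MonoidHom.id_apply, ← map_smul]; rfl
  map_zero' := map_zero (F θ 1)
  map_add' a b := by rw [← map_add]; rfl
  map_mul' a b := by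
    rw [F_mul_F]
    refine F_congr (one_mul 1).symm ?_
    exact (maps_one (a * b)).eq
      ((maps_one a).mulCoeff (a := ⟨a, mem_one a⟩) (b := (⟨b, mem_one b⟩ : θ.D 1)))
  map_star' a := by
    rw [star_F]
    refine F_congr inv_one.symm ?_
    exact (maps_one (star a)).inj (θ.maps_starCoeff 1 ⟨a, mem_one a⟩)

/-- Every element of `L_c` has bounded C*-seminorms. -/
instance : IsCStarBounded θ.Sections where
  bddAbove f := by
    induction f using Sections.induction with
    | h0 => exact ⟨0, by rintro _ ⟨p, rfl⟩; simp⟩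
    | hadd f₁ f₂ h₁ h₂ =>
      obtain ⟨c₁, h₁⟩ := h₁
      obtain ⟨c₂, h₂⟩ := h₂
      refine ⟨c₁ + c₂, ?_⟩
      rintro _ ⟨p, rfl⟩
      exact (map_add_le_add p.toSeminorm f₁ f₂).trans
        (add_le_add (h₁ ⟨p, rfl⟩) (h₂ ⟨p, rfl⟩))
    | hF s a =>
      obtain ⟨m, hm⟩ : ∃ m, star (F θ s a) * F θ s a = incl θ m := by
        refine ⟨θ.mulCoeff s⁻¹ s (θ.starCoeff s a) a, ?_⟩
        rw [star_F, F_mul_F]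
        exact F_congr (inv_mul_cancel s) rfl
      refine ⟨Real.sqrt ‖m‖, ?_⟩
      rintro _ ⟨p, rfl⟩
      refine Real.le_sqrt_of_sq_le ?_
      rw [sq, ← p.star_mul_self, hm, ← p.norm_toCompletion]
      exact NonUnitalStarAlgHom.norm_apply_le (p.toCompletion.comp (incl θ)) m

end Sections

/-! ### The crossed product -/

/-- The partial crossed product `A ⋊ G`: the C*-completion of `L_c` in its greatest
C*-seminorm. -/
def CrossedProduct : Type (max u v) := EnvelopingCStar θ.Sections

instance : NonUnitalCStarAlgebra θ.CrossedProduct :=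
  inferInstanceAs (NonUnitalCStarAlgebra (EnvelopingCStar θ.Sections))

/-- The canonical *-homomorphism of `L_c` into the crossed product. -/
def ofSections : θ.Sections →⋆ₙₐ[ℂ] θ.CrossedProduct := EnvelopingCStar.of (L := θ.Sections)

/-- The canonical map of `A` into the crossed product. -/
def ι : A →⋆ₙₐ[ℂ] θ.CrossedProduct := θ.ofSections.comp (Sections.incl θ)

/-- `F(a,s)` as an element of the crossed product. -/
def F (s : G) (a : θ.D s) : θ.CrossedProduct := θ.ofSections (Sections.F θ s a)

/-- The subspace `X s = {F(a,s) | a ∈ D s}` of the crossed product, a `D s`-`D s⁻¹` imprimitivity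
bimodule under multiplication in the crossed product. -/
def X (s : G) : Submodule ℂ θ.CrossedProduct :=
  LinearMap.range
    ((θ.ofSections : θ.Sections →ₗ[ℂ] θ.CrossedProduct) ∘ₗ Sections.F θ s)

/-- A multiplier of the `D s`-`D s⁻¹` bimodule `X s`: a pair of module maps `D s → X s` and
`D s⁻¹ → X s`, written `c ↦ c · m` and `d ↦ m · d`, such that `(c · m) d = c (m · d)`. -/
structure BimoduleMultiplier (s : G) where
  left : θ.D s →ₗ[ℂ] θ.X s
  right : θ.D s⁻¹ →ₗ[ℂ] θ.X s
  left_mul : ∀ c c' : θ.D s, (left (c' * c) : θ.CrossedProduct) = θ.ι c' * left c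
  right_mul : ∀ d d' : θ.D s⁻¹, (right (d * d') : θ.CrossedProduct) = right d * θ.ι d'
  compat : ∀ (c : θ.D s) (d : θ.D s⁻¹),
    (left c : θ.CrossedProduct) * θ.ι d = θ.ι c * right d

theorem F_mem_X (s : G) (a : θ.D s) : θ.F s a ∈ θ.X s := ⟨a, rfl⟩

/-- `a ↦ F(a,s)` as a linear map of `D s` into `X s`. -/
def toX (s : G) : θ.D s →ₗ[ℂ] θ.X s where
  toFun a := ⟨θ.F s a, θ.F_mem_X s a⟩
  map_add' a b := Subtype.ext <| by simp [F]
  map_smul' c a := Subtype.ext <| by simp [F]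

theorem ι_mul_F (s : G) (c : A) (a b : θ.D s) (h : (b : A) = c * a) :
    θ.ι c * θ.F s a = θ.F s b := by
  change θ.ofSections (Sections.F θ 1 ⟨c, mem_one c⟩) * θ.ofSections _ = _
  rw [← map_mul, Sections.F_mul_F]
  refine congrArg _ (Sections.F_congr (one_mul s) ?_)
  rw [h]
  exact ((maps_one c).mulCoeff (a := ⟨c, mem_one c⟩) (b := a)).eq (maps_one (c * a))

theorem F_mul_ι (s : G) (a b : θ.D s) (d a' : A) (ha : θ.Maps s a' a) (hb : θ.Maps s (a' * d) b) :
    θ.F s a * θ.ι d = θ.F s b := by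
  change θ.ofSections _ * θ.ofSections (Sections.F θ 1 ⟨d, mem_one d⟩) = _
  rw [← map_mul, Sections.F_mul_F]
  refine congrArg _ (Sections.F_congr (mul_one s) ?_)
  exact (ha.mulCoeff (b := (⟨d, mem_one d⟩ : θ.D 1))).eq hb

/-- The multiplier `m s` of `X s`, given by `a · m s = F(a,s)` and `m s · b = F(α s (b),s)`. -/
def m (s : G) : θ.BimoduleMultiplier s where
  left := θ.toX s
  right := θ.toX s ∘ₗ (θ.α s : θ.D s⁻¹ →ₗ[ℂ] θ.D s)
  left_mul c c' := (θ.ι_mul_F s c' c (c' * c) rfl).symm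
  right_mul d d' := (θ.F_mul_ι s (θ.α s d) (θ.α s (d * d')) d' d (maps_apply s d)
    (maps_apply s (d * d'))).symm
  compat c d := by
    have hc := maps_symm s c
    have hd := maps_apply s d
    have h := hc.mul hd
    exact (θ.F_mul_ι s c (c * θ.α s d) d _ hc h).trans
      (θ.ι_mul_F s c (θ.α s d) (c * θ.α s d) rfl).symm

end PartialAction

/-! ### The minimal (spatial) tensor product of C*-algebras -/

section TensorAlgebra

variable {B C : Type*} [NonUnitalRing B] [StarRing B] [Module ℂ B] [IsScalarTower ℂ B B]
  [SMulCommClass ℂ B B] [StarModule ℂ B] [NonUnitalRing C] [StarRing C] [Module ℂ C]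
  [IsScalarTower ℂ C C] [SMulCommClass ℂ C C] [StarModule ℂ C]

instance : StarRing (B ⊗[ℂ] C) where
  __ := (inferInstance : StarAddMonoid (B ⊗[ℂ] C))
  star_mul x y := by
    induction x using TensorProduct.induction_on with
    | zero => simp
    | add x₁ x₂ h₁ h₂ => rw [add_mul, star_add, h₁, h₂, star_add, mul_add]
    | tmul b c =>
      induction y using TensorProduct.induction_on with
      | zero => simp
      | add x₁ x₂ h₁ h₂ => rw [mul_add, star_add, h₁, h₂, star_add, add_mul]
      | tmul b' c' => simp [Algebra.TensorProduct.tmul_mul_tmul, star_mul]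

/-- A linear map on `B ⊗ C` which respects products and adjoints of elementary tensors is a
*-homomorphism. -/
def tensorStarHom {X : Type*} [NonUnitalRing X] [StarRing X] [Module ℂ X]
    (f : B ⊗[ℂ] C →ₗ[ℂ] X)
    (hmul : ∀ b c b' c', f ((b * b') ⊗ₜ (c * c')) = f (b ⊗ₜ c) * f (b' ⊗ₜ c'))
    (hstar : ∀ b c, f (star b ⊗ₜ star c) = star (f (b ⊗ₜ c))) : B ⊗[ℂ] C →⋆ₙₐ[ℂ] X where
  __ := f
  map_zero' := map_zero f
  map_mul' x y := by
    change f (x * y) = f x * f y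
    induction x using TensorProduct.induction_on with
    | zero => simp
    | add x₁ x₂ h₁ h₂ => rw [add_mul, map_add, h₁, h₂, map_add, add_mul]
    | tmul b c =>
      induction y using TensorProduct.induction_on with
      | zero => simp
      | add x₁ x₂ h₁ h₂ => rw [mul_add, map_add, h₁, h₂, map_add, mul_add]
      | tmul b' c' => rw [Algebra.TensorProduct.tmul_mul_tmul, hmul]
  map_star' x := by
    change f (star x) = star (f x)
    induction x using TensorProduct.induction_on with
    | zero => simp
    | add x₁ x₂ h₁ h₂ => rw [star_add, map_add, h₁, h₂, map_add, star_add]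
    | tmul b c => rw [TensorProduct.star_tmul, hstar]

/-- The algebraic tensor product of two *-homomorphisms. -/
def tensorMapHom {B' C' : Type*} [NonUnitalRing B'] [StarRing B'] [Module ℂ B']
    [IsScalarTower ℂ B' B'] [SMulCommClass ℂ B' B'] [StarModule ℂ B'] [NonUnitalRing C']
    [StarRing C'] [Module ℂ C'] [IsScalarTower ℂ C' C'] [SMulCommClass ℂ C' C'] [StarModule ℂ C']
    (φ : B →⋆ₙₐ[ℂ] B') (ψ : C →⋆ₙₐ[ℂ] C') : B ⊗[ℂ] C →⋆ₙₐ[ℂ] B' ⊗[ℂ] C' :=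
  tensorStarHom (TensorProduct.map (φ : B →ₗ[ℂ] B') (ψ : C →ₗ[ℂ] C'))
    (fun b c b' c' => by simp [Algebra.TensorProduct.tmul_mul_tmul])
    (fun b c => by simp [map_star])

theorem tensorMapHom_tmul {B' C' : Type*} [NonUnitalRing B'] [StarRing B'] [Module ℂ B']
    [IsScalarTower ℂ B' B'] [SMulCommClass ℂ B' B'] [StarModule ℂ B'] [NonUnitalRing C']
    [StarRing C'] [Module ℂ C'] [IsScalarTower ℂ C' C'] [SMulCommClass ℂ C' C'] [StarModule ℂ C']
    (φ : B →⋆ₙₐ[ℂ] B') (ψ : C →⋆ₙₐ[ℂ] C') (b : B) (c : C) :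
    tensorMapHom φ ψ (b ⊗ₜ c) = φ b ⊗ₜ ψ c := rfl

/-- The associativity isomorphism of algebraic tensor products, as a *-homomorphism. -/
def tensorAssocHom {D : Type*} [NonUnitalRing D] [StarRing D] [Module ℂ D] [IsScalarTower ℂ D D]
    [SMulCommClass ℂ D D] [StarModule ℂ D] :
    (B ⊗[ℂ] C) ⊗[ℂ] D →⋆ₙₐ[ℂ] B ⊗[ℂ] (C ⊗[ℂ] D) :=
  tensorStarHom (B := B ⊗[ℂ] C) (C := D) (X := B ⊗[ℂ] (C ⊗[ℂ] D))
    (TensorProduct.assoc ℂ B C D).toLinearMap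
    (fun x d x' d' => by
      induction x using TensorProduct.induction_on with
      | zero => simp
      | add x₁ x₂ h₁ h₂ =>
        rw [add_mul, TensorProduct.add_tmul, map_add, h₁, h₂, TensorProduct.add_tmul, map_add,
          add_mul]
      | tmul b c =>
        induction x' using TensorProduct.induction_on with
        | zero => simp
        | add x₁ x₂ h₁ h₂ =>
          rw [mul_add, TensorProduct.add_tmul, map_add, h₁, h₂, TensorProduct.add_tmul, map_add,
            mul_add]
        | tmul b' c' => simp [Algebra.TensorProduct.tmul_mul_tmul])
    (fun x d => by
      induction x using TensorProduct.induction_on with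
      | zero => simp
      | add x₁ x₂ h₁ h₂ =>
        rw [star_add, TensorProduct.add_tmul, map_add, h₁, h₂, TensorProduct.add_tmul, map_add,
          star_add]
      | tmul b c => simp)

theorem tensorAssocHom_tmul {D : Type*} [NonUnitalRing D] [StarRing D] [Module ℂ D]
    [IsScalarTower ℂ D D] [SMulCommClass ℂ D D] [StarModule ℂ D] (b : B) (c : C) (d : D) :
    tensorAssocHom ((b ⊗ₜ[ℂ] c) ⊗ₜ[ℂ] d) = b ⊗ₜ[ℂ] (c ⊗ₜ[ℂ] d) := rfl

end TensorAlgebra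

/-- A *-representation of a *-algebra by bounded operators on a (not necessarily complete) inner
product space. -/
structure PreRep (L : Type*) [NonUnitalRing L] [StarRing L] [Module ℂ L] (E : Type*)
    [NormedAddCommGroup E] [InnerProductSpace ℂ E] where
  toHom : L →ₙₐ[ℂ] (E →L[ℂ] E)
  adjoint : ∀ (x : L) (ξ η : E), inner ℂ (toHom x ξ) η = inner ℂ ξ (toHom (star x) η)

namespace PreRep

section

variable {E F : Type*} [NormedAddCommGroup E] [InnerProductSpace ℂ E] [NormedAddCommGroup F]
  [InnerProductSpace ℂ F]

open UniformSpace in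
/-- The *-representation on the Hilbert space completion. -/
def completion {L : Type*} [NonUnitalRing L] [StarRing L] [Module ℂ L] (P : PreRep L E) :
    L →⋆ₙₐ[ℂ] (Completion E →L[ℂ] Completion E) where
  toFun x := (P.toHom x).completion
  map_smul' c x := by
    ext z
    induction z using Completion.induction_on with
    | hp => exact isClosed_eq (ContinuousLinearMap.continuous _) (ContinuousLinearMap.continuous _)
    | ih z => simp [Completion.coe_smul]
  map_zero' := by
    ext z
    induction z using Completion.induction_on with
    | hp => exact isClosed_eq (ContinuousLinearMap.continuous _) (ContinuousLinearMap.continuous _)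
    | ih z => simp
  map_add' x y := by
    ext z
    induction z using Completion.induction_on with
    | hp => exact isClosed_eq (ContinuousLinearMap.continuous _) (ContinuousLinearMap.continuous _)
    | ih z => simp [Completion.coe_add]
  map_mul' x y := by
    ext z
    induction z using Completion.induction_on with
    | hp => exact isClosed_eq (ContinuousLinearMap.continuous _) (ContinuousLinearMap.continuous _)
    | ih z => simp
  map_star' x := by
    refine (ContinuousLinearMap.eq_adjoint_iff _ _).mpr fun ξ η => ?_
    induction ξ, η using Completion.induction_on₂ with
    | hp => exact isClosed_eq (by fun_prop) (by fun_prop)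
    | ih ξ η =>
      simp only [ContinuousLinearMap.completion_apply_coe, Completion.inner_coe]
      rw [P.adjoint, star_star]

open UniformSpace in
theorem completion_coe {L : Type*} [NonUnitalRing L] [StarRing L] [Module ℂ L] (P : PreRep L E)
    (x : L) (ξ : E) : P.completion x (ξ : Completion E) = (P.toHom x ξ : E) :=
  ContinuousLinearMap.completion_apply_coe _ ξ

open UniformSpace in
theorem norm_completion {L : Type*} [NonUnitalRing L] [StarRing L] [Module ℂ L] (P : PreRep L E)
    (x : L) : ‖P.completion x‖ = ‖P.toHom x‖ := by
  apply le_antisymm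
  · refine ContinuousLinearMap.opNorm_le_bound _ (norm_nonneg _) fun ξ => ?_
    induction ξ using Completion.induction_on with
    | hp => exact isClosed_le (by fun_prop) (by fun_prop)
    | ih ξ =>
      rw [completion_coe, Completion.norm_coe, Completion.norm_coe]
      exact ContinuousLinearMap.le_opNorm _ _
  · refine ContinuousLinearMap.opNorm_le_bound _ (norm_nonneg _) fun ξ => ?_
    rw [← Completion.norm_coe, ← completion_coe, ← Completion.norm_coe ξ]
    exact ContinuousLinearMap.le_opNorm _ _

/-- The C*-seminorm `x ↦ ‖P x‖` of a representation, the norm being that of the operator on the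
Hilbert space completion. -/
def seminorm {L : Type*} [NonUnitalRing L] [StarRing L] [Module ℂ L] (P : PreRep L E) :
    CStarSeminorm L :=
  CStarSeminorm.ofHom
    (B := UniformSpace.Completion E →L[ℂ] UniformSpace.Completion E) P.completion

theorem seminorm_apply {L : Type*} [NonUnitalRing L] [StarRing L] [Module ℂ L] (P : PreRep L E)
    (x : L) : P.seminorm x = ‖P.toHom x‖ :=
  P.norm_completion x

/-- The extension of a representation to the completion in a C*-seminorm. -/
def extend {L : Type*} [NonUnitalRing L] [StarRing L] [Module ℂ L] [IsScalarTower ℂ L L]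
    [SMulCommClass ℂ L L] [StarModule ℂ L] (P : PreRep L E) (p : CStarSeminorm L)
    (h : ∀ x, P.seminorm x ≤ p x) :
    p.Completion →⋆ₙₐ[ℂ] (UniformSpace.Completion E →L[ℂ] UniformSpace.Completion E) :=
  p.lift (B := UniformSpace.Completion E →L[ℂ] UniformSpace.Completion E) P.completion h

theorem extend_coe {L : Type*} [NonUnitalRing L] [StarRing L] [Module ℂ L] [IsScalarTower ℂ L L]
    [SMulCommClass ℂ L L] [StarModule ℂ L] (P : PreRep L E) (p : CStarSeminorm L)
    (h : ∀ x, P.seminorm x ≤ p x) (x : L) (ξ : E) :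
    P.extend p h (p.toCompletion x) (ξ : UniformSpace.Completion E) =
      ((P.toHom x ξ : E) : UniformSpace.Completion E) := by
  rw [← completion_coe]
  exact congrArg (fun T : UniformSpace.Completion E →L[ℂ] UniformSpace.Completion E => T ξ)
    (p.lift_coe (B := UniformSpace.Completion E →L[ℂ] UniformSpace.Completion E) P.completion h x)

/-- Operators intertwined by an isometry. -/
theorem norm_le_of_intertwine (V : E →ₗᵢ[ℂ] F) (S : E →L[ℂ] E) (T : F →L[ℂ] F)
    (h : ∀ ξ, V (S ξ) = T (V ξ)) : ‖S‖ ≤ ‖T‖ := by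
  refine ContinuousLinearMap.opNorm_le_bound _ (norm_nonneg _) fun ξ => ?_
  rw [← V.norm_map, h, ← V.norm_map ξ]
  exact ContinuousLinearMap.le_opNorm _ _

variable {B C : Type*} [NonUnitalRing B] [StarRing B] [Module ℂ B] [IsScalarTower ℂ B B]
  [SMulCommClass ℂ B B] [StarModule ℂ B] [NonUnitalRing C] [StarRing C] [Module ℂ C]
  [IsScalarTower ℂ C C] [SMulCommClass ℂ C C] [StarModule ℂ C]

/-- The linear map `b ⊗ c ↦ P b ⊗ Q c`. -/
def tensorₗ (P : PreRep B E) (Q : PreRep C F) :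
    B ⊗[ℂ] C →ₗ[ℂ] ((E ⊗[ℂ] F) →L[ℂ] (E ⊗[ℂ] F)) :=
  TensorProduct.lift <| LinearMap.mk₂ ℂ
    (fun b c => TensorProduct.mapL (P.toHom b) (Q.toHom c))
    (fun b b' c => by rw [map_add, TensorProduct.mapL_add_left])
    (fun r b c => by rw [map_smul, TensorProduct.mapL_smul_left])
    (fun b c c' => by rw [map_add, TensorProduct.mapL_add_right])
    (fun r b c => by rw [map_smul, TensorProduct.mapL_smul_right])

theorem tensorₗ_tmul (P : PreRep B E) (Q : PreRep C F) (b : B) (c : C) :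
    tensorₗ P Q (b ⊗ₜ c) = TensorProduct.mapL (P.toHom b) (Q.toHom c) := rfl

/-- The tensor product of two *-representations, acting on the tensor product of the inner product
spaces by `(b ⊗ c) (ξ ⊗ η) = b ξ ⊗ c η`. -/
def tensor (P : PreRep B E) (Q : PreRep C F) : PreRep (B ⊗[ℂ] C) (E ⊗[ℂ] F) where
  toHom :=
    { tensorₗ P Q with
      map_zero' := map_zero (tensorₗ P Q)
      map_mul' := fun x y => by
        change tensorₗ P Q (x * y) = tensorₗ P Q x * tensorₗ P Q y
        induction x using TensorProduct.induction_on with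
        | zero => simp
        | add x₁ x₂ h₁ h₂ => rw [add_mul, map_add, h₁, h₂, map_add, add_mul]
        | tmul b c =>
          induction y using TensorProduct.induction_on with
          | zero => simp
          | add x₁ x₂ h₁ h₂ => rw [mul_add, map_add, h₁, h₂, map_add, mul_add]
          | tmul b' c' =>
            rw [Algebra.TensorProduct.tmul_mul_tmul, tensorₗ_tmul, tensorₗ_tmul, tensorₗ_tmul,
              map_mul, map_mul, TensorProduct.mapL_mul] }
  adjoint x ξ η := by
    change inner ℂ (tensorₗ P Q x ξ) η = inner ℂ ξ (tensorₗ P Q (star x) η)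
    induction x using TensorProduct.induction_on with
    | zero => simp
    | add x₁ x₂ h₁ h₂ =>
      rw [star_add, map_add, map_add, add_apply, add_apply, inner_add_left, inner_add_right, h₁, h₂]
    | tmul b c =>
      rw [TensorProduct.star_tmul, tensorₗ_tmul, tensorₗ_tmul]
      induction ξ using TensorProduct.induction_on with
      | zero => simp
      | add ξ₁ ξ₂ h₁ h₂ => rw [map_add, inner_add_left, inner_add_left, h₁, h₂]
      | tmul e f =>
        induction η using TensorProduct.induction_on with
        | zero => simp
        | add ξ₁ ξ₂ h₁ h₂ => rw [map_add, inner_add_right, inner_add_right, h₁, h₂]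
        | tmul e' f' =>
          rw [TensorProduct.mapL_tmul, TensorProduct.mapL_tmul, TensorProduct.inner_tmul,
            TensorProduct.inner_tmul, P.adjoint, Q.adjoint]

theorem tensor_tmul (P : PreRep B E) (Q : PreRep C F) (b : B) (c : C) :
    (tensor P Q).toHom (b ⊗ₜ c) = TensorProduct.mapL (P.toHom b) (Q.toHom c) := rfl

end

end PreRep

/-- A representation of the C*-algebra `B` on a Hilbert space. The universe of the Hilbert space is
that of `B`, which is large enough for all cyclic representations and for the universal one. -/
structure HilbertRep (B : Type u) [NonUnitalCStarAlgebra B] : Type (u + 1) where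
  H : Type u
  [normedAddCommGroup : NormedAddCommGroup H]
  [innerProductSpace : InnerProductSpace ℂ H]
  [completeSpace : CompleteSpace H]
  π : B →⋆ₙₐ[ℂ] (H →L[ℂ] H)

namespace HilbertRep

attribute [instance] normedAddCommGroup innerProductSpace completeSpace

variable {B : Type u} [NonUnitalCStarAlgebra B]

/-- A representation on a Hilbert space as a representation on an inner product space. -/
def pre (R : HilbertRep B) : PreRep B R.H where
  toHom := (R.π : B →ₙₐ[ℂ] (R.H →L[ℂ] R.H))
  adjoint x ξ η := by
    change inner ℂ (R.π x ξ) η = inner ℂ ξ (R.π (star x) η)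
    rw [map_star, ContinuousLinearMap.star_eq_adjoint, ContinuousLinearMap.adjoint_inner_right]

theorem norm_pre_le (R : HilbertRep B) (b : B) : ‖R.pre.toHom b‖ ≤ ‖b‖ :=
  NonUnitalStarAlgHom.norm_apply_le R.π b

/-- The composition of a representation with a *-homomorphism. -/
abbrev comp {B' : Type u} [NonUnitalCStarAlgebra B'] (R : HilbertRep B') (φ : B →⋆ₙₐ[ℂ] B') :
    HilbertRep B where
  H := R.H
  π := R.π.comp φ

end HilbertRep

section MinTensor

variable (B : Type u) (C : Type v) (D : Type w) [NonUnitalCStarAlgebra B]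
  [NonUnitalCStarAlgebra C] [NonUnitalCStarAlgebra D]

variable {B C D} in
/-- The C*-seminorm `‖(π ⊗ ρ)(x)‖` on `B ⊗ C` of two representations, where `π ⊗ ρ` acts on the
Hilbert space tensor product (the completion of the algebraic one). -/
def repSeminorm (R : HilbertRep B × HilbertRep C) : CStarSeminorm (B ⊗[ℂ] C) :=
  (PreRep.tensor R.1.pre R.2.pre).seminorm

variable {B C D} in
theorem repSeminorm_apply (R : HilbertRep B × HilbertRep C) (x : B ⊗[ℂ] C) :
    repSeminorm R x = ‖(PreRep.tensor R.1.pre R.2.pre).toHom x‖ :=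
  PreRep.seminorm_apply _ x

variable {B C D} in
theorem repSeminorm_tmul_le (R : HilbertRep B × HilbertRep C) (b : B) (c : C) :
    repSeminorm R (b ⊗ₜ c) ≤ ‖b‖ * ‖c‖ := by
  rw [repSeminorm_apply, PreRep.tensor_tmul]
  exact (TensorProduct.norm_mapL_le _ _).trans
    (mul_le_mul (R.1.norm_pre_le b) (R.2.norm_pre_le c) (norm_nonneg _) (norm_nonneg _))

theorem bddAbove_repSeminorm (x : B ⊗[ℂ] C) :
    BddAbove (Set.range fun R : HilbertRep B × HilbertRep C => repSeminorm R x) := by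
  induction x using TensorProduct.induction_on with
  | zero => exact ⟨0, by rintro _ ⟨p, rfl⟩; simp⟩
  | add x₁ x₂ h₁ h₂ =>
    obtain ⟨c₁, h₁⟩ := h₁
    obtain ⟨c₂, h₂⟩ := h₂
    refine ⟨c₁ + c₂, ?_⟩
    rintro _ ⟨R, rfl⟩
    exact (map_add_le_add (repSeminorm R).toSeminorm x₁ x₂).trans
      (add_le_add (h₁ ⟨R, rfl⟩) (h₂ ⟨R, rfl⟩))
  | tmul b c =>
    refine ⟨‖b‖ * ‖c‖, ?_⟩
    rintro _ ⟨R, rfl⟩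
    exact repSeminorm_tmul_le R b c

/-- The minimal (spatial) C*-norm on the algebraic tensor product `B ⊗ C`: the supremum of
`‖(π ⊗ ρ)(x)‖` over all Hilbert space representations `π` of `B` and `ρ` of `C`. -/
def spatialSeminorm : CStarSeminorm (B ⊗[ℂ] C) :=
  CStarSeminorm.sup repSeminorm (bddAbove_repSeminorm B C)

/-- The minimal (spatial) tensor product of the C*-algebras `B` and `C`. -/
def MinTensor : Type (max u v) := (spatialSeminorm B C).Completion

instance : NonUnitalCStarAlgebra (MinTensor B C) :=
  inferInstanceAs (NonUnitalCStarAlgebra (spatialSeminorm B C).Completion)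

/-- The C*-seminorm `‖(π ⊗ ρ ⊗ σ)(x)‖` on `B ⊗ C ⊗ D` of three representations. -/
def repSeminorm₃ (R : HilbertRep B × HilbertRep C × HilbertRep D) :
    CStarSeminorm (B ⊗[ℂ] (C ⊗[ℂ] D)) :=
  (PreRep.tensor R.1.pre (PreRep.tensor R.2.1.pre R.2.2.pre)).seminorm

theorem bddAbove_repSeminorm₃ (x : B ⊗[ℂ] (C ⊗[ℂ] D)) :
    BddAbove (Set.range fun R : HilbertRep B × HilbertRep C × HilbertRep D =>
      repSeminorm₃ B C D R x) := by
  have hadd : ∀ x₁ x₂ : B ⊗[ℂ] (C ⊗[ℂ] D),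
      BddAbove (Set.range fun R => repSeminorm₃ B C D R x₁) →
      BddAbove (Set.range fun R => repSeminorm₃ B C D R x₂) →
      BddAbove (Set.range fun R => repSeminorm₃ B C D R (x₁ + x₂)) := by
    rintro x₁ x₂ ⟨c₁, h₁⟩ ⟨c₂, h₂⟩
    refine ⟨c₁ + c₂, ?_⟩
    rintro _ ⟨R, rfl⟩
    exact (map_add_le_add (repSeminorm₃ B C D R).toSeminorm x₁ x₂).trans
      (add_le_add (h₁ ⟨R, rfl⟩) (h₂ ⟨R, rfl⟩))
  induction x using TensorProduct.induction_on with
  | zero => exact ⟨0, by rintro _ ⟨p, rfl⟩; simp⟩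
  | add x₁ x₂ h₁ h₂ => exact hadd _ _ h₁ h₂
  | tmul b y =>
    induction y using TensorProduct.induction_on with
    | zero => exact ⟨0, by rintro _ ⟨p, rfl⟩; simp⟩
    | add x₁ x₂ h₁ h₂ => rw [TensorProduct.tmul_add]; exact hadd _ _ h₁ h₂
    | tmul c d =>
      refine ⟨‖b‖ * (‖c‖ * ‖d‖), ?_⟩
      rintro _ ⟨R, rfl⟩
      dsimp only
      rw [repSeminorm₃, PreRep.seminorm_apply]
      rw [PreRep.tensor_tmul, PreRep.tensor_tmul]
      refine (TensorProduct.norm_mapL_le _ _).trans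
        (mul_le_mul (R.1.norm_pre_le b) ?_ (norm_nonneg _) (norm_nonneg _))
      exact (TensorProduct.norm_mapL_le _ _).trans
        (mul_le_mul (R.2.1.norm_pre_le c) (R.2.2.norm_pre_le d) (norm_nonneg _) (norm_nonneg _))

/-- The spatial C*-norm on the algebraic tensor product of three C*-algebras. -/
def spatialSeminorm₃ : CStarSeminorm (B ⊗[ℂ] (C ⊗[ℂ] D)) :=
  CStarSeminorm.sup (repSeminorm₃ B C D) (bddAbove_repSeminorm₃ B C D)

/-- The minimal (spatial) tensor product of three C*-algebras. -/
def MinTensor₃ : Type (max u v w) := (spatialSeminorm₃ B C D).Completion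

instance : NonUnitalCStarAlgebra (MinTensor₃ B C D) :=
  inferInstanceAs (NonUnitalCStarAlgebra (spatialSeminorm₃ B C D).Completion)

/-- The canonical *-homomorphism of the algebraic tensor product into the spatial one. -/
def MinTensor₃.of : B ⊗[ℂ] (C ⊗[ℂ] D) →⋆ₙₐ[ℂ] MinTensor₃ B C D :=
  (spatialSeminorm₃ B C D).toCompletion

variable {B C D} in
theorem MinTensor₃.norm_of (x : B ⊗[ℂ] (C ⊗[ℂ] D)) : ‖of B C D x‖ = spatialSeminorm₃ B C D x :=
  (spatialSeminorm₃ B C D).norm_toCompletion x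

namespace MinTensor

/-- The canonical *-homomorphism of the algebraic tensor product into the spatial one. -/
def of : B ⊗[ℂ] C →⋆ₙₐ[ℂ] MinTensor B C := (spatialSeminorm B C).toCompletion

variable {B C D}

theorem norm_of (x : B ⊗[ℂ] C) : ‖of B C x‖ = spatialSeminorm B C x :=
  (spatialSeminorm B C).norm_toCompletion x

theorem denseRange_of : DenseRange (of B C) := (spatialSeminorm B C).denseRange_toCompletion

/-- The elementary tensor `b ⊗ c`. -/
def tmul (b : B) (c : C) : MinTensor B C := of B C (b ⊗ₜ c)

theorem norm_tmul_le (b : B) (c : C) : ‖tmul b c‖ ≤ ‖b‖ * ‖c‖ := by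
  rw [tmul, norm_of]
  exact CStarSeminorm.sup_le _ _ (mul_nonneg (norm_nonneg _) (norm_nonneg _))
    fun R => repSeminorm_tmul_le R b c

/-- The elementary tensors as a continuous bilinear map. -/
def tmulL : B →L[ℂ] C →L[ℂ] MinTensor B C :=
  LinearMap.mkContinuous₂
    (LinearMap.mk₂ ℂ tmul
      (fun b b' c => by simp [tmul, TensorProduct.add_tmul])
      (fun r b c => by rw [tmul, ← TensorProduct.smul_tmul', map_smul, tmul])
      (fun b c c' => by simp [tmul, TensorProduct.tmul_add])
      (fun r b c => by simp [tmul])) 1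
    (fun b c => by rw [one_mul]; exact norm_tmul_le b c)

/-- The tensor product `φ ⊗ ψ : B ⊗ C → B' ⊗ C'` of two *-homomorphisms. -/
def map {B' : Type u} {C' : Type v} [NonUnitalCStarAlgebra B'] [NonUnitalCStarAlgebra C']
    (φ : B →⋆ₙₐ[ℂ] B') (ψ : C →⋆ₙₐ[ℂ] C') : MinTensor B C →⋆ₙₐ[ℂ] MinTensor B' C' :=
  (spatialSeminorm B C).lift ((of B' C').comp (tensorMapHom φ ψ))
    (fun x => by
      rw [NonUnitalStarAlgHom.comp_apply, norm_of]
      refine CStarSeminorm.sup_le _ _ (CStarSeminorm.nonneg _ _) fun R => ?_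
      refine le_trans (le_of_eq ?_)
        (CStarSeminorm.le_sup repSeminorm (bddAbove_repSeminorm B C) (R.1.comp φ, R.2.comp ψ) x)
      rw [repSeminorm_apply, repSeminorm_apply]
      dsimp only
      congr 1
      induction x using TensorProduct.induction_on with
      | zero => simp
      | add x₁ x₂ h₁ h₂ => rw [map_add, map_add, h₁, h₂, map_add]
      | tmul b c => rfl)

theorem map_tmul {B' : Type u} {C' : Type v} [NonUnitalCStarAlgebra B'] [NonUnitalCStarAlgebra C']
    (φ : B →⋆ₙₐ[ℂ] B') (ψ : C →⋆ₙₐ[ℂ] C') (b : B) (c : C) :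
    map φ ψ (tmul b c) = tmul (φ b) (ψ c) :=
  CStarSeminorm.lift_coe (spatialSeminorm B C) ((of B' C').comp (tensorMapHom φ ψ)) _ (b ⊗ₜ c)

/-- The representation `π ⊗ ρ` of the minimal tensor product. -/
def rep (R : HilbertRep B) (S : HilbertRep C) : HilbertRep (MinTensor B C) where
  H := UniformSpace.Completion (R.H ⊗[ℂ] S.H)
  π := (PreRep.tensor R.pre S.pre).extend (spatialSeminorm B C)
    (CStarSeminorm.le_sup repSeminorm (bddAbove_repSeminorm B C) (R, S))

theorem rep_coe (R : HilbertRep B) (S : HilbertRep C) (x : B ⊗[ℂ] C) (ξ : R.H ⊗[ℂ] S.H) :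
    (rep R S).pre.toHom (of B C x)
      (ξ : UniformSpace.Completion (R.H ⊗[ℂ] S.H)) =
      (((PreRep.tensor R.pre S.pre).toHom x ξ : R.H ⊗[ℂ] S.H) :
        UniformSpace.Completion (R.H ⊗[ℂ] S.H)) :=
  PreRep.extend_coe _ _
    (CStarSeminorm.le_sup repSeminorm (bddAbove_repSeminorm B C) (R, S)) x ξ

end MinTensor

end MinTensor

/-! ### Associativity -/

/-- The *-homomorphisms of a *-algebra into a C*-algebra. -/
abbrev StarHom (L : Type*) [NonUnitalRing L] [StarRing L] [Module ℂ L] (X : Type*)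
    [NonUnitalCStarAlgebra X] : Type _ := L →⋆ₙₐ[ℂ] X

section DenseExtension

variable {L : Type*} [NonUnitalRing L] [StarRing L] [Module ℂ L] {X Y : Type*}
  [NonUnitalCStarAlgebra X] [NonUnitalCStarAlgebra Y]

theorem extendHom_aux (e : L →⋆ₙₐ[ℂ] X) (φ : L →⋆ₙₐ[ℂ] Y) (he : DenseRange e)
    (h : ∀ x, ‖φ x‖ ≤ ‖e x‖) (x : L) :
    (φ : L →ₗ[ℂ] Y).extendOfNorm (e : L →ₗ[ℂ] X) (e x) = φ x :=
  LinearMap.extendOfNorm_eq (f := (φ : L →ₗ[ℂ] Y)) (e := (e : L →ₗ[ℂ] X)) he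
    ⟨1, fun x => by rw [one_mul]; exact h x⟩ x

/-- The *-homomorphism `X → Y` which sends `e x` to `φ x`, where `e : L → X` has dense range and
`‖φ x‖ ≤ ‖e x‖`. -/
def extendHom (e : L →⋆ₙₐ[ℂ] X) (φ : L →⋆ₙₐ[ℂ] Y) (he : DenseRange e)
    (h : ∀ x, ‖φ x‖ ≤ ‖e x‖) : X →⋆ₙₐ[ℂ] Y where
  __ := (φ : L →ₗ[ℂ] Y).extendOfNorm (e : L →ₗ[ℂ] X)
  map_zero' := map_zero ((φ : L →ₗ[ℂ] Y).extendOfNorm (e : L →ₗ[ℂ] X))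
  map_mul' x y := by
    set Φ := (φ : L →ₗ[ℂ] Y).extendOfNorm (e : L →ₗ[ℂ] X) with hΦ
    refine he.induction_on₂ (p := fun x y => Φ (x * y) = Φ x * Φ y) ?_ (fun a b => ?_) x y
    · exact isClosed_eq (by fun_prop) (by fun_prop)
    · rw [← map_mul, hΦ, extendHom_aux e φ he h, extendHom_aux e φ he h, extendHom_aux e φ he h,
        map_mul]
  map_star' x := by
    set Φ := (φ : L →ₗ[ℂ] Y).extendOfNorm (e : L →ₗ[ℂ] X) with hΦ
    refine he.induction_on (p := fun x => Φ (star x) = star (Φ x)) x ?_ (fun a => ?_)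
    · exact isClosed_eq (by fun_prop) (by fun_prop)
    · rw [← map_star, hΦ, extendHom_aux e φ he h, extendHom_aux e φ he h, map_star]

theorem extendHom_apply (e : L →⋆ₙₐ[ℂ] X) (φ : L →⋆ₙₐ[ℂ] Y) (he : DenseRange e)
    (h : ∀ x, ‖φ x‖ ≤ ‖e x‖) (x : L) : extendHom e φ he h (e x) = φ x :=
  extendHom_aux e φ he h x

end DenseExtension

section Intertwine

variable {X Y Z E₁ E₂ E₃ F : Type*} [AddCommGroup X] [Module ℂ X] [AddCommGroup Y] [Module ℂ Y]
  [AddCommGroup Z] [Module ℂ Z] [NormedAddCommGroup E₁] [InnerProductSpace ℂ E₁]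
  [NormedAddCommGroup E₂] [InnerProductSpace ℂ E₂] [NormedAddCommGroup F] [InnerProductSpace ℂ F]

theorem intertwine_right (V : E₁ ⊗[ℂ] E₂ →ₗᵢ[ℂ] F)
    (Φ : X ⊗[ℂ] Y → (E₁ ⊗[ℂ] E₂ →L[ℂ] E₁ ⊗[ℂ] E₂)) (Ψ : X ⊗[ℂ] Y → (F →L[ℂ] F))
    (hΦ₀ : Φ 0 = 0) (hΨ₀ : Ψ 0 = 0) (hΦ : ∀ x y, Φ (x + y) = Φ x + Φ y)
    (hΨ : ∀ x y, Ψ (x + y) = Ψ x + Ψ y)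
    (h : ∀ x y e f, V (Φ (x ⊗ₜ y) (e ⊗ₜ f)) = Ψ (x ⊗ₜ y) (V (e ⊗ₜ f)))
    (x : X ⊗[ℂ] Y) (ξ : E₁ ⊗[ℂ] E₂) : V (Φ x ξ) = Ψ x (V ξ) := by
  induction x using TensorProduct.induction_on with
  | zero => simp only [hΦ₀, hΨ₀, map_zero, zero_apply]
  | add x₁ x₂ h₁ h₂ => simp only [hΦ, hΨ, map_add, add_apply, h₁, h₂]
  | tmul x y =>
    induction ξ using TensorProduct.induction_on with
    | zero => simp only [map_zero]
    | add x₁ x₂ h₁ h₂ => simp only [map_add, h₁, h₂]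
    | tmul e f => exact h x y e f

variable [NormedAddCommGroup E₃] [InnerProductSpace ℂ E₃]

theorem intertwine_left (V : E₁ ⊗[ℂ] (E₂ ⊗[ℂ] E₃) →ₗᵢ[ℂ] F)
    (Φ : (X ⊗[ℂ] Y) ⊗[ℂ] Z → (E₁ ⊗[ℂ] (E₂ ⊗[ℂ] E₃) →L[ℂ] E₁ ⊗[ℂ] (E₂ ⊗[ℂ] E₃)))
    (Ψ : (X ⊗[ℂ] Y) ⊗[ℂ] Z → (F →L[ℂ] F))
    (hΦ₀ : Φ 0 = 0) (hΨ₀ : Ψ 0 = 0) (hΦ : ∀ x y, Φ (x + y) = Φ x + Φ y)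
    (hΨ : ∀ x y, Ψ (x + y) = Ψ x + Ψ y)
    (h : ∀ x y z e f g, V (Φ ((x ⊗ₜ y) ⊗ₜ z) (e ⊗ₜ (f ⊗ₜ g))) =
      Ψ ((x ⊗ₜ y) ⊗ₜ z) (V (e ⊗ₜ (f ⊗ₜ g))))
    (x : (X ⊗[ℂ] Y) ⊗[ℂ] Z) (ξ : E₁ ⊗[ℂ] (E₂ ⊗[ℂ] E₃)) : V (Φ x ξ) = Ψ x (V ξ) := by
  refine intertwine_right V Φ Ψ hΦ₀ hΨ₀ hΦ hΨ (fun w z e ζ => ?_) x ξ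
  induction w using TensorProduct.induction_on with
  | zero => simp only [TensorProduct.zero_tmul, hΦ₀, hΨ₀, map_zero, zero_apply]
  | add x₁ x₂ h₁ h₂ => simp only [TensorProduct.add_tmul, hΦ, hΨ, map_add, add_apply, h₁, h₂]
  | tmul x y =>
    induction ζ using TensorProduct.induction_on with
    | zero => simp only [TensorProduct.tmul_zero, map_zero]
    | add x₁ x₂ h₁ h₂ => simp only [TensorProduct.tmul_add, map_add, h₁, h₂]
    | tmul f g => exact h x y z e f g

end Intertwine

namespace MinTensor

variable {B : Type u} {C : Type v} {D : Type w} [NonUnitalCStarAlgebra B]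
  [NonUnitalCStarAlgebra C] [NonUnitalCStarAlgebra D]

/-- A *-homomorphism into a minimal tensor product has dense range if the closure of its range
contains the elementary tensors. -/
theorem denseRange_of_tmul {L : Type*} [NonUnitalRing L] [StarRing L] [Module ℂ L]
    (e : L →⋆ₙₐ[ℂ] MinTensor B C) (h : ∀ b c, tmul b c ∈ closure (Set.range e)) :
    DenseRange e := by
  have hcl : ∀ x : B ⊗[ℂ] C, of B C x ∈
      (LinearMap.range (e : L →ₗ[ℂ] MinTensor B C)).topologicalClosure := by
    intro x
    induction x using TensorProduct.induction_on with
    | zero => rw [map_zero]; exact zero_mem _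
    | add x₁ x₂ h₁ h₂ => rw [map_add]; exact add_mem h₁ h₂
    | tmul b c => exact h b c
  intro x
  refine (denseRange_of (B := B) (C := C)).induction_on
    (p := fun x => x ∈ closure (Set.range e)) x isClosed_closure fun a => hcl a

variable (B C D)

/-- The canonical map of the algebraic tensor product into `(B ⊗ C) ⊗ D`. -/
def assocLeftMap : StarHom ((B ⊗[ℂ] C) ⊗[ℂ] D) (MinTensor (MinTensor B C) D) :=
  (of (MinTensor B C) D).comp
    (tensorMapHom (of B C) (NonUnitalStarAlgHom.id ℂ D))

/-- The canonical map of the algebraic tensor product into `B ⊗ (C ⊗ D)`. -/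
def assocRightMap : StarHom (B ⊗[ℂ] (C ⊗[ℂ] D)) (MinTensor B (MinTensor C D)) :=
  (of B (MinTensor C D)).comp
    (tensorMapHom (NonUnitalStarAlgHom.id ℂ B) (of C D))

/-- The canonical map of `(B ⊗ C) ⊗ D` into the triple tensor product. -/
def assocLeftTo : StarHom ((B ⊗[ℂ] C) ⊗[ℂ] D) (MinTensor₃ B C D) :=
  (MinTensor₃.of B C D).comp tensorAssocHom

/-- The canonical map of `B ⊗ (C ⊗ D)` into the triple tensor product. -/
def assocRightTo : StarHom (B ⊗[ℂ] (C ⊗[ℂ] D)) (MinTensor₃ B C D) := MinTensor₃.of B C D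

theorem denseRange_assocLeftMap : DenseRange (assocLeftMap B C D) := by
  refine denseRange_of_tmul _ fun x d => ?_
  refine (denseRange_of (B := B) (C := C)).induction_on
    (p := fun x => tmul x d ∈ closure (Set.range (assocLeftMap B C D))) x ?_ fun a => ?_
  · exact isClosed_closure.preimage
      ((tmulL (B := MinTensor B C) (C := D)).flip d).continuous
  · exact subset_closure ⟨a ⊗ₜ d, rfl⟩

theorem denseRange_assocRightMap : DenseRange (assocRightMap B C D) := by
  refine denseRange_of_tmul _ fun b x => ?_
  refine (denseRange_of (B := C) (C := D)).induction_on
    (p := fun x => tmul b x ∈ closure (Set.range (assocRightMap B C D))) x ?_ fun a => ?_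
  · exact isClosed_closure.preimage (tmulL b).continuous
  · exact subset_closure ⟨b ⊗ₜ a, rfl⟩

set_option maxHeartbeats 1000000 in
theorem norm_assocLeftMap_ge (x : (B ⊗[ℂ] C) ⊗[ℂ] D) :
    ‖(assocLeftTo B C D) x‖ ≤ ‖assocLeftMap B C D x‖ := by
  refine (MinTensor₃.norm_of _).trans_le ?_
  refine CStarSeminorm.sup_le _ _ (norm_nonneg _) fun R => ?_
  rw [assocLeftMap, NonUnitalStarAlgHom.comp_apply, norm_of]
  refine le_trans ?_ (CStarSeminorm.le_sup repSeminorm (bddAbove_repSeminorm (MinTensor B C) D)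
    (rep R.1 R.2.1, R.2.2) _)
  rw [repSeminorm_apply, repSeminorm₃, PreRep.seminorm_apply]
  let V : R.1.H ⊗[ℂ] (R.2.1.H ⊗[ℂ] R.2.2.H) →ₗᵢ[ℂ]
      UniformSpace.Completion (R.1.H ⊗[ℂ] R.2.1.H) ⊗[ℂ] R.2.2.H :=
    (TensorProduct.mapIsometry UniformSpace.Completion.toComplₗᵢ .id).comp
      (TensorProduct.assocIsometry ℂ R.1.H R.2.1.H R.2.2.H).symm.toLinearIsometry
  refine PreRep.norm_le_of_intertwine V _ _ fun ξ => ?_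
  refine intertwine_left V
    (fun x => (PreRep.tensor R.1.pre (PreRep.tensor R.2.1.pre R.2.2.pre)).toHom (tensorAssocHom x))
    (fun x => (PreRep.tensor (rep R.1 R.2.1).pre R.2.2.pre).toHom
      (tensorMapHom (of B C) (NonUnitalStarAlgHom.id ℂ D) x))
    (by rw [map_zero, map_zero]) (by rw [map_zero, map_zero])
    (fun x y => by rw [map_add, map_add]) (fun x y => by rw [map_add, map_add]) ?_ x ξ
  intro b c d e f g
  exact congrArg (fun z => z ⊗ₜ[ℂ] (R.2.2.pre.toHom d g))
    (rep_coe R.1 R.2.1 (b ⊗ₜ c) (e ⊗ₜ f)).symm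

theorem norm_assocRightMap_ge (x : B ⊗[ℂ] (C ⊗[ℂ] D)) :
    ‖assocRightTo B C D x‖ ≤ ‖assocRightMap B C D x‖ := by
  refine (MinTensor₃.norm_of _).trans_le ?_
  refine CStarSeminorm.sup_le _ _ (norm_nonneg _) fun R => ?_
  rw [assocRightMap, NonUnitalStarAlgHom.comp_apply, norm_of]
  refine le_trans ?_ (CStarSeminorm.le_sup repSeminorm (bddAbove_repSeminorm B (MinTensor C D))
    (R.1, rep R.2.1 R.2.2) _)
  rw [repSeminorm_apply, repSeminorm₃, PreRep.seminorm_apply]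
  let V : R.1.H ⊗[ℂ] (R.2.1.H ⊗[ℂ] R.2.2.H) →ₗᵢ[ℂ]
      R.1.H ⊗[ℂ] UniformSpace.Completion (R.2.1.H ⊗[ℂ] R.2.2.H) :=
    TensorProduct.mapIsometry .id UniformSpace.Completion.toComplₗᵢ
  refine PreRep.norm_le_of_intertwine V _ _ fun ξ => ?_
  refine intertwine_right V
    (fun x => (PreRep.tensor R.1.pre (PreRep.tensor R.2.1.pre R.2.2.pre)).toHom x)
    (fun x => (PreRep.tensor R.1.pre (rep R.2.1 R.2.2).pre).toHom
      (tensorMapHom (NonUnitalStarAlgHom.id ℂ B) (of C D) x))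
    (map_zero _) (by rw [map_zero, map_zero])
    (fun x y => map_add _ x y) (fun x y => by rw [map_add, map_add]) ?_ x ξ
  intro b y e ζ
  exact congrArg (fun z => (R.1.pre.toHom b e) ⊗ₜ[ℂ] z) (rep_coe R.2.1 R.2.2 y ζ).symm

/-- The canonical identification of `(B ⊗ C) ⊗ D` with `B ⊗ C ⊗ D`, determined by
`(b ⊗ c) ⊗ d ↦ b ⊗ c ⊗ d`. -/
def assocLeft : MinTensor (MinTensor B C) D →⋆ₙₐ[ℂ] MinTensor₃ B C D :=
  extendHom (assocLeftMap B C D) (assocLeftTo B C D)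
    (denseRange_assocLeftMap B C D) (norm_assocLeftMap_ge B C D)

/-- The canonical identification of `B ⊗ (C ⊗ D)` with `B ⊗ C ⊗ D`, determined by
`b ⊗ (c ⊗ d) ↦ b ⊗ c ⊗ d`. -/
def assocRight : MinTensor B (MinTensor C D) →⋆ₙₐ[ℂ] MinTensor₃ B C D :=
  extendHom (assocRightMap B C D) (assocRightTo B C D)
    (denseRange_assocRightMap B C D) (norm_assocRightMap_ge B C D)

variable {B C D}

theorem assocLeft_tmul (b : B) (c : C) (d : D) :
    assocLeft B C D (tmul (tmul b c) d) =
      (MinTensor₃.of B C D) (b ⊗ₜ (c ⊗ₜ d)) :=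
  extendHom_apply _ _ (denseRange_assocLeftMap B C D) (norm_assocLeftMap_ge B C D) ((b ⊗ₜ c) ⊗ₜ d)

theorem assocRight_tmul (b : B) (c : C) (d : D) :
    assocRight B C D (tmul b (tmul c d)) =
      (MinTensor₃.of B C D) (b ⊗ₜ (c ⊗ₜ d)) :=
  extendHom_apply _ _ (denseRange_assocRightMap B C D) (norm_assocRightMap_ge B C D)
    (b ⊗ₜ (c ⊗ₜ d))

end MinTensor

/-! ### Coactions of discrete groups -/

section Coaction

variable {G : Type v} [Group G]

/-- Every *-homomorphism of the group algebra into a C*-algebra extends to `C*(G)`. -/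
def GroupCStar.lift {B : Type*} [NonUnitalCStarAlgebra B] (φ : MonoidAlgebra ℂ G →⋆ₙₐ[ℂ] B) :
    GroupCStar G →⋆ₙₐ[ℂ] B :=
  EnvelopingCStar.lift φ

theorem GroupCStar.lift_of {B : Type*} [NonUnitalCStarAlgebra B]
    (φ : MonoidAlgebra ℂ G →⋆ₙₐ[ℂ] B) (f : MonoidAlgebra ℂ G) : lift φ (of G f) = φ f :=
  EnvelopingCStar.lift_of φ f

open MonoidAlgebra in
theorem GroupCStar.unitary_mul (s t : G) : unitary (s * t) = unitary s * unitary t := by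
  rw [unitary, unitary, unitary, ← map_mul, MonoidAlgebra.single_mul_single, one_mul]

open MonoidAlgebra in
theorem GroupCStar.star_unitary (s : G) : star (unitary s) = unitary s⁻¹ := by
  rw [unitary, unitary, ← map_star, MonoidAlgebra.star_single, star_one]

/-- The linear map `s ↦ s ⊗ s` of the group algebra into `C*(G) ⊗ C*(G)`. -/
def groupComulₗ : MonoidAlgebra ℂ G →ₗ[ℂ] MinTensor (GroupCStar G) (GroupCStar G) :=
  (Finsupp.linearCombination ℂ fun s : G =>
    MinTensor.tmul (GroupCStar.unitary s) (GroupCStar.unitary s)) ∘ₗ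
    (MonoidAlgebra.coeffLinearEquiv ℂ).toLinearMap

theorem groupComulₗ_single (s : G) (c : ℂ) :
    groupComulₗ (MonoidAlgebra.single s c) =
      c • MinTensor.tmul (GroupCStar.unitary s) (GroupCStar.unitary s) := by
  simp [groupComulₗ]

/-- The *-homomorphism `s ↦ s ⊗ s` of the group algebra into `C*(G) ⊗ C*(G)`. -/
def groupComulₐ : MonoidAlgebra ℂ G →⋆ₙₐ[ℂ] MinTensor (GroupCStar G) (GroupCStar G) where
  __ := groupComulₗ (G := G)
  map_zero' := map_zero (groupComulₗ (G := G))
  map_mul' f g := by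
    change groupComulₗ (f * g) = groupComulₗ f * groupComulₗ g
    induction f using MonoidAlgebra.induction_linear with
    | zero => simp only [zero_mul, map_zero]
    | add f₁ f₂ h₁ h₂ => rw [add_mul, map_add, h₁, h₂, map_add, add_mul]
    | single s c =>
      induction g using MonoidAlgebra.induction_linear with
      | zero => simp only [mul_zero, map_zero]
      | add f₁ f₂ h₁ h₂ => rw [mul_add, map_add, h₁, h₂, map_add, mul_add]
      | single t d =>
        rw [MonoidAlgebra.single_mul_single, groupComulₗ_single, groupComulₗ_single,
          groupComulₗ_single, smul_mul_smul_comm, GroupCStar.unitary_mul, MinTensor.tmul,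
          MinTensor.tmul, MinTensor.tmul, ← map_mul, Algebra.TensorProduct.tmul_mul_tmul]
  map_star' f := by
    change groupComulₗ (star f) = star (groupComulₗ f)
    induction f using MonoidAlgebra.induction_linear with
    | zero => simp only [star_zero, map_zero]
    | add f₁ f₂ h₁ h₂ => rw [star_add, map_add, h₁, h₂, map_add, star_add]
    | single s c =>
      rw [MonoidAlgebra.star_single, groupComulₗ_single, groupComulₗ_single, star_smul,
        MinTensor.tmul, MinTensor.tmul, ← map_star, TensorProduct.star_tmul,
        GroupCStar.star_unitary]

variable (G)

/-- The comultiplication `δ_G : C*(G) → C*(G) ⊗ C*(G)`, determined by `s ↦ s ⊗ s`. -/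
def GroupCStar.comul : GroupCStar G →⋆ₙₐ[ℂ] MinTensor (GroupCStar G) (GroupCStar G) :=
  GroupCStar.lift groupComulₐ

variable {G}

theorem GroupCStar.comul_unitary (s : G) :
    GroupCStar.comul G (unitary s) = MinTensor.tmul (unitary s) (unitary s) := by
  rw [comul, unitary, lift_of]
  change groupComulₗ (MonoidAlgebra.single s 1) = _
  rw [groupComulₗ_single, one_smul, unitary]

/-- A (full) coaction of the discrete group `G` on the C*-algebra `B`: an injective nondegenerate
*-homomorphism `δ : B → B ⊗ C*(G)` into the minimal tensor product, satisfying the coaction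
identity `(δ ⊗ id) ∘ δ = (id ⊗ δ_G) ∘ δ`. -/
structure IsCoaction {B : Type (max w v)} [NonUnitalCStarAlgebra B]
    (δ : B →⋆ₙₐ[ℂ] MinTensor B (GroupCStar G)) : Prop where
  injective : Function.Injective δ
  nondegenerate : Dense (Submodule.span ℂ {z : MinTensor B (GroupCStar G) |
    ∃ (b : B) (y : MinTensor B (GroupCStar G)), z = δ b * y} : Set (MinTensor B (GroupCStar G)))
  coaction_identity : ∀ b : B,
    MinTensor.assocLeft B (GroupCStar G) (GroupCStar G)
        (MinTensor.map δ (NonUnitalStarAlgHom.id ℂ (GroupCStar G)) (δ b)) =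
      MinTensor.assocRight B (GroupCStar G) (GroupCStar G)
        (MinTensor.map (NonUnitalStarAlgHom.id ℂ B) (GroupCStar.comul G) (δ b))

/-- The spectral subspace `B_s = {b | δ b = b ⊗ s}` of a coaction. -/
def spectralSubspace {B : Type u} [NonUnitalCStarAlgebra B]
    (δ : B →⋆ₙₐ[ℂ] MinTensor B (GroupCStar G)) (s : G) : Set B :=
  {b | δ b = MinTensor.tmul b (GroupCStar.unitary s)}

end Coaction

end

/-! The assignment F(a,s) ↦ F(a,s) ⊗ s is multiplicative and *-preserving on `L_c`, because the
product of fibres over s and t lies over st. Since A ⋊ G carries the greatest C*-seminorm, the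
assignment extends to a *-homomorphism δ. Two *-homomorphisms that agree on all F(a,s) coincide by
density. This gives uniqueness, and it also gives the coaction identity, both sides of which send
F(a,s) to F(a,s) ⊗ s ⊗ s. Nondegeneracy comes from δ(F(a,s))(x ⊗ s⁻¹c) = F(a,s)x ⊗ c together with
an approximate unit.

Injectivity and the spectral subspaces are read off through slice maps id ⊗ ω, where ω is a matrix
coefficient of a permutation representation of G. The trivial representation yields a left inverse
of δ. The coefficient t ↦ ⟨e_s, λ_t e_1⟩ of the regular representation yields a continuous E_s = (id
⊗ ω) ∘ δ which fixes F(a,s) and kills F(a,t) for t ≠ s. If δ(b) = b ⊗ s, then b = E_s(b), which lies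
in the closure of X_s.

Two analytic facts carry this. First, slices are bounded for the spatial norm
(`MinTensor.norm_sliceₗ_le`); this uses that every element attains its norm in some representation,
hence states, the Riesz extension theorem and GNS. Secondly, X_s is closed (`isClosed_X`). The
injectivity of ι : A → A ⋊ G is not needed for that: functional calculus replaces a by some b with
F(b,s) = F(a,s) and ‖b‖ ≤ ‖F(a,s)‖, so X_s is the image of a complete space under a map with
norm-controlled lifts. -/

noncomputable section

/-! ### States and norm-attaining representations -/

section States

open scoped ComplexOrder

variable {A : Type*} [CStarAlgebra A] [PartialOrder A] [StarOrderedRing A]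

/-- The convex cone of those `y` for which `y + y* + t (‖x‖ - x)` is nonnegative for some
`t ≥ 0`. -/
def stateCone (x : A) : PointedCone ℝ A where
  -- The cone contains the positive elements, every skew-adjoint element with both signs, and x -
  -- ‖x‖. A real functional that is nonnegative on it is therefore positive, vanishes on
  -- skew-adjoint elements and, if it sends 1 to 1, is at least ‖x‖ at x.
  carrier := {y | ∃ t : ℝ, 0 ≤ t ∧ 0 ≤ y + star y + t • (‖x‖ • (1 : A) - x)}
  add_mem' := by
    rintro a b ⟨t, ht, ha⟩ ⟨r, hr, hb⟩
    refine ⟨t + r, add_nonneg ht hr, (add_nonneg ha hb).trans_eq ?_⟩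
    rw [star_add, add_smul]
    abel
  zero_mem' := ⟨0, le_rfl, by simp⟩
  smul_mem' := by
    rintro ⟨c, hc⟩ a ⟨t, ht, ha⟩
    refine ⟨c * t, mul_nonneg hc ht, (smul_nonneg hc ha).trans_eq ?_⟩
    change c • _ = c • a + star (c • a) + _
    rw [star_smul, star_trivial c, smul_add, smul_add, smul_smul]

/-- This makes the functional c • 1 ↦ c compatible with the cone, as the extension theorem requires.
If c < 0, membership gives 0 ≤ t x ≤ t‖x‖ + 2c, which contradicts ‖t x‖ = t‖x‖ when the right side
is nonnegative and forces a negative multiple of 1 to vanish otherwise. -/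
theorem nonneg_of_smul_one_mem_stateCone [Nontrivial A] {x : A} (hx : 0 ≤ x) {c : ℝ}
    (hc : c • (1 : A) ∈ stateCone x) : 0 ≤ c := by
  obtain ⟨t, ht, h⟩ := hc
  by_contra! hlt
  have h1 : t • x ≤ (t * ‖x‖ + 2 * c) • (1 : A) := by
    rw [← sub_nonneg]
    refine h.trans_eq ?_
    rw [star_smul, star_one, star_trivial c, smul_sub, smul_smul, add_smul, two_mul, add_smul]
    abel
  have h2 : 0 ≤ t • x := smul_nonneg ht hx
  have h3 := CStarAlgebra.norm_le_norm_of_nonneg_of_le h2 h1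
  rw [norm_smul, norm_smul, norm_one, mul_one, Real.norm_eq_abs, Real.norm_eq_abs,
    abs_of_nonneg ht] at h3
  rcases abs_cases (t * ‖x‖ + 2 * c) with ⟨h4, h5⟩ | ⟨h4, h5⟩
  · linarith
  · have h6 : 0 ≤ (-(t * ‖x‖ + 2 * c)) • (1 : A) :=
      smul_nonneg (by linarith) (zero_le_one' A)
    rw [neg_smul, neg_nonneg] at h6
    have h7 := le_antisymm h6 (h2.trans h1)
    rw [smul_eq_zero_iff_left one_ne_zero] at h7
    exact h5.ne h7

/-- For every nonnegative element `x` of a unital C*-algebra there is a state `f` with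
`f x = ‖x‖`. -/
theorem exists_state_apply_eq_norm [Nontrivial A] {x : A} (hx : 0 ≤ x) :
    ∃ f : A →ₚ[ℂ] ℂ, f 1 = 1 ∧ f x = ‖x‖ := by
  obtain ⟨g, hg1, hg⟩ := riesz_extension (stateCone x)
    (LinearPMap.mkSpanSingleton (1 : A) (1 : ℝ) one_ne_zero) (by
      rintro ⟨y, hy⟩ h
      obtain ⟨c, rfl⟩ := Submodule.mem_span_singleton.1 hy
      erw [LinearPMap.mkSpanSingleton'_apply]
      rw [RingHom.id_apply, smul_eq_mul, mul_one]
      exact nonneg_of_smul_one_mem_stateCone hx h) (by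
      intro y
      -- Every y is moved into the cone by a multiple of 1: y + y* + 2‖y + y*‖ is nonnegative, so t
      -- = 0 suffices.
      refine ⟨⟨‖y + star y‖ • (1 : A), Submodule.mem_span_singleton.2 ⟨_, rfl⟩⟩, 0, le_rfl, ?_⟩
      have h1 : -(y + star y) ≤ ‖y + star y‖ • (1 : A) := by
        rw [← norm_neg, ← Algebra.algebraMap_eq_smul_one]
        exact IsSelfAdjoint.le_algebraMap_norm_self (IsSelfAdjoint.add_star_self y).neg
      have h2 : 0 ≤ ‖y + star y‖ • (1 : A) := smul_nonneg (norm_nonneg _) (zero_le_one' A)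
      rw [zero_smul, add_zero, star_add, star_smul, star_one, star_trivial (‖y + star y‖)]
      rw [neg_le_iff_add_nonneg] at h1
      refine (add_nonneg h1 h2).trans_eq ?_
      abel)
  have g1 : g 1 = 1 := by
    have := hg1 ⟨1, Submodule.mem_span_singleton_self _⟩
    rw [this, LinearPMap.mkSpanSingleton_apply]
  have hpos : ∀ y : A, 0 ≤ y → 0 ≤ g y := fun y hy => hg y ⟨0, le_rfl, by
    rw [zero_smul, add_zero, (IsSelfAdjoint.of_nonneg hy).star_eq]
    exact add_nonneg hy hy⟩
  have hskew : ∀ y : A, y + star y = 0 → g y = 0 := by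
    intro y hy
    have h1 := hg y ⟨0, le_rfl, by rw [hy]; simp⟩
    have h2 := hg (-y) ⟨0, le_rfl, by rw [star_neg, ← neg_add, hy]; simp⟩
    rw [map_neg] at h2
    linarith
  -- The complexification of g is y ↦ g y - i g(i y), and i y is skew-adjoint for self-adjoint y, so
  -- on self-adjoint elements it agrees with g.
  have hI : ∀ y : A, IsSelfAdjoint y → g (Complex.I • y) = 0 := by
    intro y hy
    apply hskew
    rw [star_smul, hy.star_eq, Complex.star_def, Complex.conj_I, neg_smul, add_neg_cancel]
  have hf : ∀ y : A, IsSelfAdjoint y → (Module.Dual.extendRCLike g : Module.Dual ℂ A) y = g y := by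
    intro y hy
    rw [Module.Dual.extendRCLike_apply]
    simp [hI y hy]
  have hxs : IsSelfAdjoint x := .of_nonneg hx
  refine ⟨PositiveLinearMap.mk₀ (Module.Dual.extendRCLike g : Module.Dual ℂ A) fun y hy => ?_, ?_, ?_⟩
  · rw [hf y (.of_nonneg hy)]
    exact_mod_cast hpos y hy
  · refine (hf 1 (.one A)).trans ?_
    rw [g1, Complex.ofReal_one]
  · refine (hf x hxs).trans ?_
    congr 1
    apply le_antisymm
    · have h1 := hpos (‖x‖ • 1 - x) (by
        rw [sub_nonneg, ← Algebra.algebraMap_eq_smul_one]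
        exact hxs.le_algebraMap_norm_self)
      rw [map_sub, map_smul, g1, smul_eq_mul, mul_one] at h1
      linarith
    · have h1 := hg (x - ‖x‖ • 1) ⟨2, zero_le_two, le_of_eq (by
        rw [star_sub, star_smul, star_one, star_trivial ‖x‖, hxs.star_eq, two_smul]
        abel)⟩
      rw [map_sub, map_smul, g1, smul_eq_mul, mul_one] at h1
      linarith

end States

/-- Every element of a C*-algebra attains its norm at a unit vector of some representation. -/
theorem HilbertRep.exists_norm_apply_eq {B : Type u} [NonUnitalCStarAlgebra B] (b : B) :
    ∃ (R : HilbertRep B) (ξ : R.H), ‖ξ‖ = 1 ∧ ‖R.pre.toHom b ξ‖ = ‖b‖ := by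
  let _ : PartialOrder (Unitization ℂ B) := CStarAlgebra.spectralOrder _
  have : StarOrderedRing (Unitization ℂ B) := CStarAlgebra.spectralOrderedRing _
  -- A state f of the unitization with f(b*b) = ‖b*b‖ is used; its GNS vector ξ = [1] satisfies ‖ξ‖²
  -- = f(1) = 1 and ‖b ξ‖² = f(b*b) = ‖b‖². The unitization supplies the vector [1] and is
  -- nontrivial even when B = 0.
  obtain ⟨f, hf1, hf⟩ := exists_state_apply_eq_norm
    (star_mul_self_nonneg (b : Unitization ℂ B))
  let R : HilbertRep B :=
    { H := f.GNS
      π := f.gnsNonUnitalStarAlgHom.comp (Unitization.inrNonUnitalStarAlgHom ℂ B) }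
  have key : ∀ a : f.PreGNS, ‖(a : f.GNS)‖ = √(f (star (f.ofPreGNS a) * f.ofPreGNS a)).re :=
    fun a => UniformSpace.Completion.norm_coe a
  refine ⟨R, (f.toPreGNS 1 : f.GNS), ?_, ?_⟩
  · refine (key _).trans ?_
    rw [f.ofPreGNS_toPreGNS, star_one, one_mul, hf1, Complex.one_re, Real.sqrt_one]
  · have h : R.pre.toHom b (f.toPreGNS 1 : f.GNS) =
        ((f.toPreGNS (b : Unitization ℂ B) : f.PreGNS) : f.GNS) := by
      refine (f.gnsNonUnitalStarAlgHom_apply_coe).trans ?_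
      rw [PositiveLinearMap.leftMulMapPreGNS_apply]
      simp
    rw [h]
    refine (key _).trans ?_
    rw [f.ofPreGNS_toPreGNS, hf, Complex.ofReal_re, CStarRing.norm_star_mul_self,
      Unitization.norm_inr, Real.sqrt_mul_self (norm_nonneg b)]

/-! ### Extension of bounded linear maps by density -/

section DenseExtension

variable {L : Type*} [NonUnitalRing L] [StarRing L] [Module ℂ L] {X Y : Type*}
  [NonUnitalCStarAlgebra X] [NormedAddCommGroup Y] [NormedSpace ℂ Y] [CompleteSpace Y]

/-- The continuous linear map `X → Y` which sends `e x` to `φ x`, where `e : L → X` has dense range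
and `φ` is bounded with respect to `e`. -/
def extendLinear (e : L →⋆ₙₐ[ℂ] X) (φ : L →ₗ[ℂ] Y) : X →L[ℂ] Y :=
  φ.extendOfNorm (e : L →ₗ[ℂ] X)

theorem extendLinear_apply (e : L →⋆ₙₐ[ℂ] X) (φ : L →ₗ[ℂ] Y) (he : DenseRange e) {c : ℝ}
    (h : ∀ x, ‖φ x‖ ≤ c * ‖e x‖) (x : L) : extendLinear e φ (e x) = φ x :=
  LinearMap.extendOfNorm_eq (f := φ) (e := (e : L →ₗ[ℂ] X)) he ⟨c, h⟩ x

end DenseExtension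

/-! ### Slice maps of minimal tensor products -/

namespace MinTensor

variable {B : Type u} {C : Type v} [NonUnitalCStarAlgebra B] [NonUnitalCStarAlgebra C]

/-- The map `b ⊗ c ↦ ⟨η, S c ζ⟩ b` on the algebraic tensor product. -/
def sliceₗ (S : HilbertRep C) (ζ η : S.H) : B ⊗[ℂ] C →ₗ[ℂ] B :=
  TensorProduct.lift <| LinearMap.mk₂ ℂ (fun b c => inner ℂ η (S.pre.toHom c ζ) • b)
    (fun b b' c => smul_add _ b b')
    (fun r b c => smul_comm _ r b)
    (fun b c c' => by rw [map_add, add_apply, inner_add_right, add_smul])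
    (fun r b c => by rw [map_smul, smul_apply, inner_smul_right, mul_smul])

/-- A matrix coefficient of the slice is a matrix coefficient of R ⊗ S between elementary vectors;
this ties the algebraic slice to the spatial norm. -/
theorem inner_tensor_tmul_tmul (R : HilbertRep B) (S : HilbertRep C) (ξ χ : R.H) (ζ η : S.H)
    (x : B ⊗[ℂ] C) :
    inner ℂ (χ ⊗ₜ[ℂ] η) ((PreRep.tensor R.pre S.pre).toHom x (ξ ⊗ₜ ζ)) =
      inner ℂ χ (R.pre.toHom (sliceₗ S ζ η x) ξ) := by
  induction x using TensorProduct.induction_on with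
  | zero => simp
  | add x₁ x₂ h₁ h₂ =>
    simp only [map_add, add_apply, inner_add_right, h₁, h₂]
  | tmul b c =>
    rw [PreRep.tensor_tmul, TensorProduct.mapL_tmul, TensorProduct.inner_tmul]
    change _ = inner ℂ χ (R.pre.toHom (inner ℂ η (S.pre.toHom c ζ) • b) ξ)
    rw [map_smul, smul_apply, inner_smul_right, mul_comm]

/-- The slice attains its norm at a unit vector ξ of some representation R. Pairing its value χ
there with itself gives a coefficient of (R ⊗ S)(x) between ξ ⊗ ζ and χ ⊗ η, which Cauchy–Schwarz
bounds by the spatial norm of x. -/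
theorem norm_sliceₗ_le (S : HilbertRep C) (ζ η : S.H) (x : B ⊗[ℂ] C) :
    ‖sliceₗ S ζ η x‖ ≤ ‖η‖ * ‖ζ‖ * ‖of B C x‖ := by
  obtain ⟨R, ξ, hξ, h⟩ := HilbertRep.exists_norm_apply_eq (sliceₗ S ζ η x)
  have hR : ‖(PreRep.tensor R.pre S.pre).toHom x‖ ≤ ‖of B C x‖ := by
    rw [← repSeminorm_apply (R, S), norm_of]
    exact CStarSeminorm.le_sup repSeminorm (bddAbove_repSeminorm B C) (R, S) x
  set χ := R.pre.toHom (sliceₗ S ζ η x) ξ with hχ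
  have h1 : ‖χ‖ * ‖χ‖ ≤ ‖χ‖ * (‖η‖ * ‖ζ‖ * ‖of B C x‖) := by
    calc ‖χ‖ * ‖χ‖ = ‖inner ℂ χ χ‖ := by
          rw [inner_self_eq_norm_sq_to_K, norm_pow, RCLike.norm_ofReal, abs_norm, sq]
      _ = ‖inner ℂ (χ ⊗ₜ[ℂ] η) ((PreRep.tensor R.pre S.pre).toHom x (ξ ⊗ₜ ζ))‖ := by
          rw [inner_tensor_tmul_tmul]
      _ ≤ ‖χ ⊗ₜ[ℂ] η‖ * (‖(PreRep.tensor R.pre S.pre).toHom x‖ * ‖ξ ⊗ₜ[ℂ] ζ‖) :=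
          (norm_inner_le_norm _ _).trans
            (mul_le_mul_of_nonneg_left (ContinuousLinearMap.le_opNorm _ _) (norm_nonneg _))
      _ ≤ ‖χ ⊗ₜ[ℂ] η‖ * (‖of B C x‖ * ‖ξ ⊗ₜ[ℂ] ζ‖) := by gcongr
      _ = ‖χ‖ * (‖η‖ * ‖ζ‖ * ‖of B C x‖) := by
          rw [TensorProduct.norm_tmul, TensorProduct.norm_tmul, hξ]
          ring
  rw [← h]
  rcases (norm_nonneg χ).eq_or_lt with h0 | h0
  · rw [← h0]; positivity
  · exact le_of_mul_le_mul_left h1 h0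

/-- The slice map `B ⊗ C → B`, `b ⊗ c ↦ ⟨η, S c ζ⟩ b`, of a vector functional on `C`. -/
def slice (S : HilbertRep C) (ζ η : S.H) : MinTensor B C →L[ℂ] B :=
  extendLinear (of B C) (sliceₗ S ζ η)

theorem slice_tmul (S : HilbertRep C) (ζ η : S.H) (b : B) (c : C) :
    slice S ζ η (tmul b c) = inner ℂ η (S.pre.toHom c ζ) • b :=
  extendLinear_apply (of B C) (sliceₗ S ζ η) denseRange_of (norm_sliceₗ_le S ζ η) (b ⊗ₜ c)

theorem tmul_mul_tmul (b b' : B) (c c' : C) :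
    tmul b c * tmul b' c' = tmul (b * b') (c * c') := by
  rw [tmul, tmul, tmul, ← map_mul, Algebra.TensorProduct.tmul_mul_tmul]

theorem star_tmul (b : B) (c : C) : star (tmul b c) = tmul (star b) (star c) := by
  rw [tmul, tmul, ← map_star, TensorProduct.star_tmul]

end MinTensor

/-! ### Permutation representations of groups -/

section Permutation

variable {X : Type v}

theorem memℓp_comp_perm (e : Equiv.Perm X) (f : lp (fun _ : X => ℂ) 2) :
    Memℓp (fun x => f (e x)) 2 := by
  have h := lp.memℓp f
  rw [memℓp_gen_iff (by norm_num)] at h ⊢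
  exact (e.summable_iff (f := fun x => ‖f x‖ ^ (2 : ENNReal).toReal)).2 h

/-- The unitary operator `f ↦ f ∘ e` on `ℓ²(X)`. -/
def l2Comp (e : Equiv.Perm X) : lp (fun _ : X => ℂ) 2 →L[ℂ] lp (fun _ : X => ℂ) 2 :=
  LinearMap.mkContinuous
    { toFun := fun f => ⟨fun x => f (e x), memℓp_comp_perm e f⟩
      map_add' := fun _ _ => rfl
      map_smul' := fun _ _ => rfl } 1 (fun f => by
      rw [one_mul, lp.norm_eq_tsum_rpow (by norm_num), lp.norm_eq_tsum_rpow (by norm_num) f]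
      exact (congrArg (· ^ (1 / (2 : ENNReal).toReal))
        (e.tsum_eq fun x => ‖f x‖ ^ (2 : ENNReal).toReal)).le)

theorem l2Comp_apply (e : Equiv.Perm X) (f : lp (fun _ : X => ℂ) 2) (x : X) :
    l2Comp e f x = f (e x) := rfl

theorem star_l2Comp (e : Equiv.Perm X) : star (l2Comp e) = l2Comp e⁻¹ := by
  rw [ContinuousLinearMap.star_eq_adjoint]
  refine ((ContinuousLinearMap.eq_adjoint_iff _ _).2 fun f g => ?_).symm
  rw [lp.inner_eq_tsum, lp.inner_eq_tsum, ← e.tsum_eq]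
  simp [l2Comp_apply]

variable (G : Type v) [Group G] (X) [MulAction G X]

/-- The unitary representation of `G` on `ℓ²(X)` given by an action on `X`. -/
def permutationHom : G →* (lp (fun _ : X => ℂ) 2 →L[ℂ] lp (fun _ : X => ℂ) 2) where
  toFun s := l2Comp (MulAction.toPerm s)⁻¹
  map_one' := by
    ext f x
    simp [l2Comp_apply]
  map_mul' s t := by
    ext f x
    simp [l2Comp_apply, mul_smul]

variable {G X} in
theorem permutationHom_apply (s : G) (f : lp (fun _ : X => ℂ) 2) (x : X) :
    permutationHom X G s f x = f (s⁻¹ • x) := rfl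

variable {G X} in
theorem star_permutationHom (s : G) : star (permutationHom X G s) = permutationHom X G s⁻¹ := by
  refine (star_l2Comp _).trans ?_
  ext f x
  rw [permutationHom_apply, l2Comp_apply, inv_inv, inv_inv]
  rfl

/-- The *-representation of the group algebra on `ℓ²(X)`. -/
def permutationAlgHom :
    MonoidAlgebra ℂ G →⋆ₙₐ[ℂ] (lp (fun _ : X => ℂ) 2 →L[ℂ] lp (fun _ : X => ℂ) 2) where
  __ := MonoidAlgebra.lift ℂ _ G (permutationHom X G)
  map_smul' c f := map_smul (MonoidAlgebra.lift ℂ _ G (permutationHom X G)) c f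
  map_zero' := map_zero (MonoidAlgebra.lift ℂ _ G (permutationHom X G))
  map_star' f := by
    change MonoidAlgebra.lift ℂ _ G (permutationHom X G) (star f) =
      star (MonoidAlgebra.lift ℂ _ G (permutationHom X G) f)
    induction f using MonoidAlgebra.induction_linear with
    | zero => simp only [star_zero, map_zero]
    | add f₁ f₂ h₁ h₂ => rw [star_add, map_add, h₁, h₂, map_add, star_add]
    | single s c =>
      rw [MonoidAlgebra.star_single, MonoidAlgebra.lift_single, MonoidAlgebra.lift_single,
        star_smul, star_permutationHom]

/-- The representation of `C*(G)` on `ℓ²(X)` given by an action of `G` on `X`. -/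
def permutationRep : HilbertRep (GroupCStar G) where
  H := lp (fun _ : X => ℂ) 2
  π := GroupCStar.lift (permutationAlgHom X G)

variable {X}

open scoped Classical in
/-- The canonical basis vectors of `ℓ²(X)`. -/
def l2Single (x : X) : lp (fun _ : X => ℂ) 2 := lp.single 2 x 1

variable {G}

open scoped Classical in
theorem inner_permutationHom (s : G) (x y : X) :
    inner ℂ (l2Single y) (permutationHom X G s (l2Single x)) = if s • x = y then (1 : ℂ) else 0 := by
  have h : permutationHom X G s (l2Single x) y = if s • x = y then (1 : ℂ) else 0 := by
    rw [permutationHom_apply, l2Single, lp.single_apply]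
    by_cases hs : s • x = y
    · subst hs
      simp
    · rw [if_neg hs, Pi.single_apply, if_neg fun h => hs (by rw [← h, smul_inv_smul])]
  rw [← h, l2Single, lp.inner_single_left]
  simp

open scoped Classical in
theorem inner_permutationRep (s : G) (x y : X) :
    inner ℂ (l2Single y : (permutationRep X G).H)
      ((permutationRep X G).pre.toHom (GroupCStar.unitary s) (l2Single x)) =
      if s • x = y then (1 : ℂ) else 0 := by
  have h : (permutationRep X G).pre.toHom (GroupCStar.unitary s) = permutationHom X G s := by
    refine (GroupCStar.lift_of (permutationAlgHom X G) _).trans ?_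
    refine (MonoidAlgebra.lift_single (permutationHom X G) s 1).trans ?_
    rw [one_smul]
  rw [h]
  exact inner_permutationHom s x y

/-- The slice map of the matrix coefficient `s ↦ ⟨y, s x⟩` of a permutation representation. -/
def MinTensor.matrixSlice {B : Type u} [NonUnitalCStarAlgebra B] (x y : X) :
    MinTensor B (GroupCStar G) →L[ℂ] B :=
  slice (permutationRep X G) (l2Single x : lp (fun _ : X => ℂ) 2)
    (l2Single y : lp (fun _ : X => ℂ) 2)

/-- Permutation representations have coefficients 0 and 1 in the canonical basis, so slicing selects
group elements. On a one-point set everything is selected; on G with x = 1 and y = s only s is. -/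
theorem MinTensor.matrixSlice_tmul_unitary {B : Type u} [NonUnitalCStarAlgebra B] (x y : X) (b : B)
    (s : G) [Decidable (s • x = y)] :
    matrixSlice x y (tmul b (GroupCStar.unitary s)) = if s • x = y then b else 0 := by
  refine (slice_tmul (permutationRep X G) _ _ b (GroupCStar.unitary s)).trans ?_
  refine (congrArg (· • b) (inner_permutationRep s x y)).trans ?_
  split_ifs
  · exact one_smul ℂ b
  · exact zero_smul ℂ b

end Permutation

/-! ### Norm-controlled lifting along *-homomorphisms -/

section Lifting

variable {A B : Type*} [NonUnitalCStarAlgebra A] [NonUnitalCStarAlgebra B]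

/-- A cut-off function which vanishes where `|t| ≤ r²` and satisfies
`|t| (1 - normCutoff r t)² ≤ r²`. -/
def normCutoff (r t : ℝ) : ℝ := 1 - r / max r √|t|

theorem normCutoff_of_le {r t : ℝ} (hr : 0 < r) (ht : |t| ≤ r ^ 2) : normCutoff r t = 0 := by
  rw [normCutoff, max_eq_left (Real.sqrt_le_iff.2 ⟨hr.le, ht⟩), div_self hr.ne', sub_self]

theorem continuous_normCutoff {r : ℝ} (hr : 0 < r) : Continuous (normCutoff r) := by
  unfold normCutoff
  exact continuous_const.sub (continuous_const.div (by fun_prop)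
    fun t => (hr.trans_le (le_max_left _ _)).ne')

/-- Here 1 - `normCutoff r t` = r / max(r, √|t|), and |t| ≤ max(r, √|t|)². -/
theorem abs_mul_one_sub_normCutoff_sq_le {r : ℝ} (hr : 0 < r) (t : ℝ) :
    |t| * (1 - normCutoff r t) ^ 2 ≤ r ^ 2 := by
  have hm : 0 < max r √|t| := hr.trans_le (le_max_left _ _)
  have h1 : |t| ≤ max r √|t| ^ 2 := by
    rw [← Real.sqrt_le_left hm.le]
    exact le_max_right _ _
  rw [normCutoff, sub_sub_cancel, div_pow, ← mul_div_assoc, div_le_iff₀ (by positivity), mul_comm]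
  exact mul_le_mul_of_nonneg_left h1 (sq_nonneg r)

/-- If `‖φ (a a*)‖ ≤ r²`, then `a` can be cut down to norm `r` by an element of the kernel
of `φ`. -/
theorem exists_map_eq_zero_and_norm_sub_mul_le (φ : A →⋆ₙₐ[ℂ] B) (a : A) {r : ℝ} (hr : 0 < r)
    (h : ‖φ (a * star a)‖ ≤ r ^ 2) : ∃ k : A, φ k = 0 ∧ ‖a - k * a‖ ≤ r := by
  set p := a * star a with hp
  have hps : IsSelfAdjoint p := .mul_star_self a
  have hg0 : normCutoff r 0 = 0 := normCutoff_of_le hr (by rw [abs_zero]; positivity)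
  have hg := continuous_normCutoff hr
  have hφ : Continuous φ := AddMonoidHomClass.continuous_of_bound φ 1 fun x => by
    rw [one_mul]; exact NonUnitalStarAlgHom.norm_apply_le φ x
  refine ⟨cfcₙ (normCutoff r) p, ?_, ?_⟩
  · have hφp : IsSelfAdjoint (φ p) := hps.map φ
    rw [NonUnitalStarAlgHom.map_cfcₙ φ (normCutoff r) p hg.continuousOn hg0 hφ hps hφp]
    -- The homomorphism carries k to the cut-off of φ(p). The quasispectrum of φ(p) lies in [-r²,
    -- r²] by the norm hypothesis, and the cut-off vanishes there.
    have : Set.EqOn (normCutoff r) (fun _ => 0) (quasispectrum ℝ (φ p)) := by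
      intro t ht
      refine normCutoff_of_le hr (le_trans ?_ h)
      have := norm_apply_le_norm_cfcₙ (id : ℝ → ℝ) (φ p) ht
      rwa [cfcₙ_id ℝ (φ p), id] at this
    rw [cfcₙ_congr this, cfcₙ_const_zero]
  · set k := cfcₙ (normCutoff r) p with hk
    have hks : star k = k := (cfcₙ_predicate (R := ℝ) (p := IsSelfAdjoint) (normCutoff r) p)
    have hu : p - k * p = cfcₙ (fun t => t - normCutoff r t * t) p := by
      rw [cfcₙ_sub _ _ p, cfcₙ_mul _ _ p, cfcₙ_id' ℝ p]
    -- The function on the right is t(1 - g(t))² with g the cut-off, expanded so that no unit is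
    -- needed; its absolute value is at most r².
    have hv : (a - k * a) * star (a - k * a) =
        cfcₙ (fun t => (t - normCutoff r t * t) - (t - normCutoff r t * t) * normCutoff r t) p := by
      rw [cfcₙ_sub _ _ p, cfcₙ_mul _ _ p, ← hu, ← hk, star_sub, star_mul, hks, hp]
      noncomm_ring
    have hn : ‖a - k * a‖ * ‖a - k * a‖ ≤ r * r := by
      rw [← CStarRing.norm_self_mul_star, hv, ← sq]
      refine norm_cfcₙ_le fun t _ => ?_
      refine le_of_eq_of_le ?_ (abs_mul_one_sub_normCutoff_sq_le hr t)
      rw [Real.norm_eq_abs, ← abs_of_nonneg (sq_nonneg (1 - normCutoff r t)), ← abs_mul]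
      congr 1
      ring
    exact abs_le_of_sq_le_sq' (by rwa [sq, sq]) hr.le |>.2

end Lifting

namespace PartialAction

variable {G : Type v} [Group G] {A : Type u} [NonUnitalCStarAlgebra A] {θ : PartialAction G A}

/-! ### The fibres of the crossed product are closed -/

/-- The product lands in the fibre over the identity, so the norm of F(a,s) is governed by ι alone.
This is what makes the lifting lemma for ι applicable to every fibre. -/
theorem F_mul_star_F (s : G) (a : θ.D s) : θ.F s a * star (θ.F s a) = θ.ι (a * star (a : A)) := by
  rw [F, ← map_star, ← map_mul, Sections.star_F, Sections.F_mul_F]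
  change θ.ofSections _ = θ.ofSections (Sections.F θ 1 ⟨_, mem_one _⟩)
  refine congrArg _ (Sections.F_congr (mul_inv_cancel s) ?_)
  exact (maps_symm s a).mulCoeff.eq ((maps_symm s a).mul (θ.maps_starCoeff s a))

theorem norm_F_mul_self (s : G) (a : θ.D s) :
    ‖θ.F s a‖ * ‖θ.F s a‖ = ‖θ.ι (a * star (a : A))‖ := by
  rw [← CStarRing.norm_self_mul_star, F_mul_star_F]

theorem norm_F_le (s : G) (a : θ.D s) : ‖θ.F s a‖ ≤ ‖(a : A)‖ := by
  refine abs_le_of_sq_le_sq' ?_ (norm_nonneg _) |>.2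
  rw [sq, sq, norm_F_mul_self, ← CStarRing.norm_self_mul_star]
  exact NonUnitalStarAlgHom.norm_apply_le θ.ι _

/-- Cutting a down by an element k of ker ι does not change F(a,s), because F(ka,s) = ι(k)F(a,s) =
0. With r = ‖F(a,s)‖, the hypothesis ‖ι(aa*)‖ ≤ r² of the cut-off lemma is an equality. -/
theorem exists_F_eq_and_norm_le (s : G) (a : θ.D s) :
    ∃ b : θ.D s, θ.F s b = θ.F s a ∧ ‖(b : A)‖ ≤ ‖θ.F s a‖ := by
  -- The cut-off needs r > 0; when F(a,s) = 0 the lift is 0.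
  rcases (norm_nonneg (θ.F s a)).eq_or_lt with h0 | h0
  · refine ⟨0, ?_, by simp⟩
    rw [norm_eq_zero.1 h0.symm, F, map_zero, map_zero]
  · obtain ⟨k, hk, hn⟩ := exists_map_eq_zero_and_norm_sub_mul_le θ.ι (a : A) h0
      (by rw [sq, norm_F_mul_self])
    refine ⟨a - ⟨k * a, θ.mul_mem_left s k a.2⟩, ?_, hn⟩
    have h1 : θ.F s ⟨k * a, θ.mul_mem_left s k a.2⟩ = 0 := by
      rw [← θ.ι_mul_F s k a _ rfl, hk, zero_mul]
    rw [F] at h1 ⊢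
    rw [map_sub, map_sub, h1, sub_zero, F]

/-- Each element of X_s has a preimage in D_s of no larger norm. A limit of elements of X_s can thus
be written as a convergent series of elements whose lifts also converge, D_s being complete. -/
theorem isClosed_X (s : G) : IsClosed (θ.X s : Set θ.CrossedProduct) := by
  have : IsClosed (θ.D s : Set A) := θ.isClosed s
  let f : NormedAddGroupHom (θ.D s) θ.CrossedProduct :=
    { toFun := θ.F s
      map_add' := fun a b => by simp only [F, map_add]
      bound' := ⟨1, fun a => by rw [one_mul]; exact norm_F_le s a⟩ }
  have hf : f.SurjectiveOnWith (θ.X s).toAddSubgroup 1 := by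
    rintro _ ⟨a, rfl⟩
    obtain ⟨b, hb, hn⟩ := exists_F_eq_and_norm_le s a
    exact ⟨b, hb, by rw [one_mul]; exact hn⟩
  refine isClosed_of_closure_subset fun x hx => ?_
  -- The first constant is the lifting constant 1; the second is the arbitrary positive loss allowed
  -- on the closure. Only the existence of a preimage is kept.
  obtain ⟨a, ha, -⟩ := controlled_closure_of_complete one_pos one_pos hf x hx
  exact ⟨a, ha⟩

/-! ### The dual coaction -/

/-- A closed additive property of elements of the crossed product holds everywhere if it holds for
the elements `F(a,s)`. -/
theorem CrossedProduct.induction {P : θ.CrossedProduct → Prop} (b : θ.CrossedProduct)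
    (hP : IsClosed {b | P b}) (h0 : P 0) (hF : ∀ s a, P (θ.F s a))
    (hadd : ∀ b c, P b → P c → P (b + c)) : P b := by
  refine (EnvelopingCStar.denseRange_of (L := θ.Sections)).induction_on (p := P) b hP fun f => ?_
  change P (θ.ofSections f)
  induction f using Sections.induction with
  | h0 => rwa [map_zero]
  | hadd f g hf hg => rw [map_add]; exact hadd _ _ hf hg
  | hF s a => exact hF s a

theorem CrossedProduct.continuousLinearMap_ext {E : Type*} [NormedAddCommGroup E] [NormedSpace ℂ E]
    {f g : θ.CrossedProduct →L[ℂ] E} (h : ∀ s a, f (θ.F s a) = g (θ.F s a)) : f = g := by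
  ext b
  induction b using CrossedProduct.induction with
  | hP => exact isClosed_eq f.continuous g.continuous
  | h0 => rw [map_zero, map_zero]
  | hF s a => exact h s a
  | hadd b c hb hc => rw [map_add, map_add, hb, hc]

/-- A *-homomorphism of C*-algebras as a continuous linear map. -/
def _root_.NonUnitalStarAlgHom.toCLM {B C : Type*} [NonUnitalCStarAlgebra B]
    [NonUnitalCStarAlgebra C] (φ : B →⋆ₙₐ[ℂ] C) : B →L[ℂ] C :=
  LinearMap.mkContinuous (φ : B →ₗ[ℂ] C) 1 fun x => by
    rw [one_mul]; exact NonUnitalStarAlgHom.norm_apply_le φ x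

/-- This serves both the uniqueness of the coaction and the coaction identity. -/
theorem CrossedProduct.hom_ext {C : Type*} [NonUnitalCStarAlgebra C]
    {φ ψ : θ.CrossedProduct →⋆ₙₐ[ℂ] C} (h : ∀ s a, φ (θ.F s a) = ψ (θ.F s a)) : φ = ψ := by
  have : φ.toCLM = ψ.toCLM := CrossedProduct.continuousLinearMap_ext h
  exact NonUnitalStarAlgHom.ext fun b => DFunLike.congr_fun this b

variable (θ)

/-- The linear map `F(a,s) ↦ F(a,s) ⊗ s` on `L_c`. -/
def dualCoactionₗ : θ.Sections →ₗ[ℂ] MinTensor θ.CrossedProduct (GroupCStar G) :=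
  Sections.lift fun s =>
    ((MinTensor.tmulL (B := θ.CrossedProduct) (C := GroupCStar G)).flip
      (GroupCStar.unitary s)).toLinearMap ∘ₗ
      (θ.ofSections : θ.Sections →ₗ[ℂ] θ.CrossedProduct) ∘ₗ Sections.F θ s

theorem dualCoactionₗ_F (s : G) (a : θ.D s) :
    θ.dualCoactionₗ (Sections.F θ s a) = MinTensor.tmul (θ.F s a) (GroupCStar.unitary s) :=
  Sections.lift_F _ s a

/-- The *-homomorphism `F(a,s) ↦ F(a,s) ⊗ s` on `L_c`. -/
def dualCoactionₐ : θ.Sections →⋆ₙₐ[ℂ] MinTensor θ.CrossedProduct (GroupCStar G) where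
  __ := θ.dualCoactionₗ
  map_zero' := map_zero θ.dualCoactionₗ
  map_mul' f g := by
    change θ.dualCoactionₗ (f * g) = θ.dualCoactionₗ f * θ.dualCoactionₗ g
    induction f using Sections.induction with
    | h0 => simp only [zero_mul, map_zero]
    | hadd f₁ f₂ h₁ h₂ => rw [add_mul, map_add, h₁, h₂, map_add, add_mul]
    | hF s a =>
      induction g using Sections.induction with
      | h0 => simp only [mul_zero, map_zero]
      | hadd f₁ f₂ h₁ h₂ => rw [mul_add, map_add, h₁, h₂, map_add, mul_add]
      | hF t b =>
        -- The grading is multiplicative: both sides are F(a,s)F(b,t) ⊗ st.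
        rw [Sections.F_mul_F, dualCoactionₗ_F, dualCoactionₗ_F, dualCoactionₗ_F,
          MinTensor.tmul_mul_tmul, ← GroupCStar.unitary_mul, F, F, F, ← map_mul, Sections.F_mul_F]
  map_star' f := by
    change θ.dualCoactionₗ (star f) = star (θ.dualCoactionₗ f)
    induction f using Sections.induction with
    | h0 => simp only [star_zero, map_zero]
    | hadd f₁ f₂ h₁ h₂ => rw [star_add, map_add, h₁, h₂, map_add, star_add]
    | hF s a =>
      rw [Sections.star_F, dualCoactionₗ_F, dualCoactionₗ_F, MinTensor.star_tmul,
        GroupCStar.star_unitary, F, F, ← map_star, Sections.star_F]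

/-- The dual coaction of `G` on the crossed product, determined by `F(a,s) ↦ F(a,s) ⊗ s`. -/
def dualCoaction : θ.CrossedProduct →⋆ₙₐ[ℂ] MinTensor θ.CrossedProduct (GroupCStar G) :=
  -- No estimate is required: the norm of the image is itself a C*-seminorm on `L_c`, hence
  -- dominated by the greatest one.
  EnvelopingCStar.lift θ.dualCoactionₐ

theorem dualCoaction_F (s : G) (a : θ.D s) :
    θ.dualCoaction (θ.F s a) = MinTensor.tmul (θ.F s a) (GroupCStar.unitary s) :=
  (EnvelopingCStar.lift_of θ.dualCoactionₐ _).trans (θ.dualCoactionₗ_F s a)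

/-- Following δ by a slice gives a continuous projection onto the fibres whose group element moves x
to y. -/
theorem matrixSlice_dualCoaction {X : Type v} [MulAction G X] (x y : X) (s : G) (a : θ.D s)
    [Decidable (s • x = y)] :
    MinTensor.matrixSlice x y (θ.dualCoaction (θ.F s a)) = if s • x = y then θ.F s a else 0 := by
  rw [dualCoaction_F, MinTensor.matrixSlice_tmul_unitary]

/-- The trivial representation of `G` provides a left inverse of the dual coaction. -/
theorem dualCoaction_injective : Function.Injective θ.dualCoaction := by
  classical
  -- The one-point G-set gives the trivial representation. It is placed in the universe of G, where
  -- the Hilbert spaces of `HilbertRep (GroupCStar G)` live.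
  let _ : MulAction G PUnit.{v + 1} :=
    { smul := fun _ x => x, one_smul := fun _ => rfl, mul_smul := fun _ _ _ => rfl }
  let σ := MinTensor.matrixSlice (B := θ.CrossedProduct) (G := G) PUnit.unit.{v + 1} PUnit.unit
  have h : σ.comp θ.dualCoaction.toCLM = .id ℂ _ :=
    CrossedProduct.continuousLinearMap_ext fun s a =>
      (θ.matrixSlice_dualCoaction PUnit.unit PUnit.unit s a).trans (if_pos rfl)
  exact Function.LeftInverse.injective (g := σ) fun b => DFunLike.congr_fun h b

theorem _root_.GroupCStar.unitary_one_mul (c : GroupCStar G) : GroupCStar.unitary 1 * c = c := by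
  refine (EnvelopingCStar.denseRange_of (L := MonoidAlgebra ℂ G)).induction_on
    (p := fun c : GroupCStar G => GroupCStar.unitary 1 * c = c) c
    (isClosed_eq (by fun_prop) (by fun_prop)) fun f => ?_
  change GroupCStar.of G (MonoidAlgebra.single 1 1) * GroupCStar.of G f = GroupCStar.of G f
  rw [← map_mul, ← MonoidAlgebra.one_def, one_mul]

theorem _root_.MinTensor.dense_of_tmul_mem {B : Type u} {C : Type v} [NonUnitalCStarAlgebra B]
    [NonUnitalCStarAlgebra C] {K : Submodule ℂ (MinTensor B C)}
    (h : ∀ b c, MinTensor.tmul b c ∈ K.topologicalClosure) : Dense (K : Set (MinTensor B C)) := by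
  intro z
  refine (MinTensor.denseRange_of (B := B) (C := C)).induction_on
    (p := fun z => z ∈ K.topologicalClosure) z isClosed_closure fun x => ?_
  induction x using TensorProduct.induction_on with
  | zero => rw [map_zero]; exact zero_mem _
  | add x₁ x₂ h₁ h₂ => rw [map_add]; exact add_mem h₁ h₂
  | tmul b c => exact h b c

-- It suffices to approximate x ⊗ c. The elements yx ⊗ c lie in the closed span for every y, by
-- reduction to y = F(a,s); letting y run through an approximate unit gives x ⊗ c.
open Filter Topology in
theorem dualCoaction_nondegenerate :
    Dense (Submodule.span ℂ {z : MinTensor θ.CrossedProduct (GroupCStar G) |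
      ∃ (b : θ.CrossedProduct) (y : MinTensor θ.CrossedProduct (GroupCStar G)),
        z = θ.dualCoaction b * y} : Set (MinTensor θ.CrossedProduct (GroupCStar G))) := by
  refine MinTensor.dense_of_tmul_mem fun x c => ?_
  set K := Submodule.span ℂ {z : MinTensor θ.CrossedProduct (GroupCStar G) |
      ∃ (b : θ.CrossedProduct) (y : MinTensor θ.CrossedProduct (GroupCStar G)),
        z = θ.dualCoaction b * y}
  let T : θ.CrossedProduct →L[ℂ] MinTensor θ.CrossedProduct (GroupCStar G) :=
    MinTensor.tmulL.flip c
  change T x ∈ K.topologicalClosure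
  have hmul : ∀ y, T (y * x) ∈ K.topologicalClosure := by
    intro y
    induction y using CrossedProduct.induction with
    | hP => exact isClosed_closure.preimage (T.continuous.comp (continuous_mul_const x))
    | h0 => rw [zero_mul, map_zero]; exact zero_mem _
    | hadd y z hy hz => rw [add_mul, map_add]; exact add_mem hy hz
    | hF s a =>
      -- The factor s⁻¹ in the second leg cancels the s produced by δ, leaving F(a,s)x ⊗ c.
      refine subset_closure (Submodule.subset_span
        ⟨θ.F s a, MinTensor.tmul x (GroupCStar.unitary s⁻¹ * c), ?_⟩)
      rw [dualCoaction_F, MinTensor.tmul_mul_tmul, ← mul_assoc, ← GroupCStar.unitary_mul,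
        mul_inv_cancel, GroupCStar.unitary_one_mul]
      rfl
  let _ : PartialOrder θ.CrossedProduct := CStarAlgebra.spectralOrder _
  have : StarOrderedRing θ.CrossedProduct := CStarAlgebra.spectralOrderedRing _
  have hl := CStarAlgebra.increasingApproximateUnit θ.CrossedProduct
  have := hl.neBot
  exact isClosed_closure.mem_of_tendsto ((T.continuous.tendsto x).comp (hl.tendsto_mul_right x))
    (Eventually.of_forall hmul)

theorem dualCoaction_coaction_identity (b : θ.CrossedProduct) :
    MinTensor.assocLeft θ.CrossedProduct (GroupCStar G) (GroupCStar G)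
        (MinTensor.map θ.dualCoaction (NonUnitalStarAlgHom.id ℂ (GroupCStar G))
          (θ.dualCoaction b)) =
      MinTensor.assocRight θ.CrossedProduct (GroupCStar G) (GroupCStar G)
        (MinTensor.map (NonUnitalStarAlgHom.id ℂ θ.CrossedProduct) (GroupCStar.comul G)
          (θ.dualCoaction b)) := by
  let φ := ((MinTensor.assocLeft θ.CrossedProduct (GroupCStar G) (GroupCStar G)).comp
    (MinTensor.map θ.dualCoaction (NonUnitalStarAlgHom.id ℂ (GroupCStar G)))).comp θ.dualCoaction
  let ψ := ((MinTensor.assocRight θ.CrossedProduct (GroupCStar G) (GroupCStar G)).comp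
    (MinTensor.map (NonUnitalStarAlgHom.id ℂ θ.CrossedProduct) (GroupCStar.comul G))).comp
      θ.dualCoaction
  have h : φ = ψ := CrossedProduct.hom_ext fun s a => by
    simp only [φ, ψ, NonUnitalStarAlgHom.comp_apply]
    rw [dualCoaction_F, MinTensor.map_tmul, MinTensor.map_tmul, dualCoaction_F,
      GroupCStar.comul_unitary]
    exact (MinTensor.assocLeft_tmul _ _ _).trans (MinTensor.assocRight_tmul _ _ _).symm
  exact DFunLike.congr_fun h b

theorem isCoaction_dualCoaction : IsCoaction θ.dualCoaction :=
  ⟨θ.dualCoaction_injective, θ.dualCoaction_nondegenerate, θ.dualCoaction_coaction_identity⟩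

/-- The spectral subspaces of the dual coaction are the fibres of the crossed product. -/
theorem spectralSubspace_dualCoaction (s : G) :
    spectralSubspace θ.dualCoaction s = Set.range (θ.F s) := by
  classical
  refine Set.Subset.antisymm (fun b hb => ?_) ?_
  -- This is the coefficient t ↦ ⟨e_s, λ_t e_1⟩ of the left regular representation, the indicator of
  -- t = s. Composed with δ it maps each F(a,t) into X_s, and hence the whole crossed product,
  -- because X_s is a closed subspace.
  · let σ := MinTensor.matrixSlice (B := θ.CrossedProduct) (G := G) (1 : G) s
    have hσ : ∀ b, (σ.comp θ.dualCoaction.toCLM) b ∈ θ.X s := by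
      intro b
      induction b using CrossedProduct.induction with
      | hP => exact (isClosed_X s).preimage (ContinuousLinearMap.continuous _)
      | h0 => rw [map_zero]; exact zero_mem _
      | hadd b c hb hc => rw [map_add]; exact add_mem hb hc
      | hF t a =>
        change σ (θ.dualCoaction (θ.F t a)) ∈ θ.X s
        rw [matrixSlice_dualCoaction]
        split_ifs with h
        · rw [smul_eq_mul, mul_one] at h
          subst h
          exact θ.F_mem_X t a
        · exact zero_mem _
    -- For b in the spectral subspace, δ(b) = b ⊗ s and the slice returns b, so b inherits
    -- membership in X_s.
    have hb' : σ (θ.dualCoaction b) = b := by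
      rw [show θ.dualCoaction b = _ from hb]
      exact (MinTensor.matrixSlice_tmul_unitary _ _ _ _).trans (if_pos (mul_one s))
    have h := hσ b
    change σ (θ.dualCoaction b) ∈ θ.X s at h
    rw [hb'] at h
    exact h
  · rintro _ ⟨a, rfl⟩
    exact θ.dualCoaction_F s a

end PartialAction

end

/-! ### Existence, uniqueness and spectral subspaces -/

theorem mainTheorem10 {G : Type v} [Group G] {A : Type u} [NonUnitalCStarAlgebra A]
    (θ : PartialAction G A) :
    (∃! δ : θ.CrossedProduct →⋆ₙₐ[ℂ] MinTensor θ.CrossedProduct (GroupCStar G),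
      IsCoaction δ ∧
        ∀ (s : G) (a : θ.D s),
          δ ((θ.m s).left a) =
            MinTensor.tmul ((θ.m s).left a : θ.CrossedProduct) (GroupCStar.unitary s)) ∧
    ∀ δ : θ.CrossedProduct →⋆ₙₐ[ℂ] MinTensor θ.CrossedProduct (GroupCStar G),
      IsCoaction δ →
      (∀ (s : G) (a : θ.D s),
          δ ((θ.m s).left a) =
            MinTensor.tmul ((θ.m s).left a : θ.CrossedProduct) (GroupCStar.unitary s)) →
      ∀ s : G,
        spectralSubspace δ s = Set.range (fun a : θ.D s => ((θ.m s).left a : θ.CrossedProduct)) ∧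
        Set.range (fun a : θ.D s => ((θ.m s).left a : θ.CrossedProduct)) =
          Set.range (fun b : θ.D s⁻¹ => ((θ.m s).right b : θ.CrossedProduct)) := by
  -- The elements a m_s are by definition the F(a,s), so a homomorphism with the prescribed values
  -- is the dual coaction.
  have huniq : ∀ δ : θ.CrossedProduct →⋆ₙₐ[ℂ] MinTensor θ.CrossedProduct (GroupCStar G),
      (∀ (s : G) (a : θ.D s),
          δ ((θ.m s).left a) =
            MinTensor.tmul ((θ.m s).left a : θ.CrossedProduct) (GroupCStar.unitary s)) →
      δ = θ.dualCoaction := fun δ hδ => PartialAction.CrossedProduct.hom_ext fun s a =>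
    (hδ s a).trans (θ.dualCoaction_F s a).symm
  refine ⟨⟨θ.dualCoaction, ⟨θ.isCoaction_dualCoaction, θ.dualCoaction_F⟩,
    fun δ hδ => huniq δ hδ.2⟩, fun δ _ hδ s => ⟨?_, ?_⟩⟩
  · rw [huniq δ hδ]
    exact θ.spectralSubspace_dualCoaction s
  -- Since m_s b = F(α_s(b),s) and α_s maps D_{s⁻¹} onto D_s, the two ranges coincide.
  · exact ((θ.α s).surjective.range_comp (θ.F s)).symm
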